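/- For each $n\in\mathbb N$ let $X^{(n)}=(X^{(n)}_t)_{t\ge 0}$ be an irreducible continuous-time Markov chain with right-continuous paths on a finite state space $\mathcal X^{(n)}$, with matrix of transition rates $Q^{(n)}$ and invariant probability measure $\pi^{(n)}$, and let $X^{\leftarrow(n)}$ be its time reversal, i.e. the Markov chain with rates $\pi^{(n)}(y)Q^{(n)}(y,x)/\pi^{(n)}(x)$. Let $A^{(n)}\subset\mathcal X^{(n)}$ be nonempty with nonempty complement $G^{(n)}=\mathcal X^{(n)}\setminus A^{(n)}$. For $K\subset \mathcal X^{(n)}$ and a starting state $x$ or a starting probability measure $\nu$, write $\tau^{x}_K$, $\tau^\nu_K$ for the first hitting time $\inf\{t\ge0: X^{(n)}_t\in K\}$, and $\tau^{\leftarrow x}_K$ for the corresponding time of $X^{\leftarrow(n)}$. Let $\pi_A^{(n)}(\cdot)=\pi^{(n)}(\cdot)\mathbf 1_{\{\cdot\in A^{(n)}\}}/\pi^{(n)}(A^{(n)})$. Fix $\alpha\in(0,1)$, and let $R_n>1$ and $f_n,r_n,d_n\in(0,1)$. Put $$B_\alpha^{(n)}=\Big\{x\in A^{(n)}:\ \tfrac12\big[\mathbf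 P(\tau^{x}_{G^{(n)}}\le 2R_n)+\mathbf P(\tau^{\leftarrow x}_{G^{(n)}}\le 2R_n)\big]\le f_n^{\alpha}\Big\}.$$ Assume that for every $n$ the hypothesis $Hp.G_n$ holds, that is: * slow escape: $\mathbf P(\tau^{\pi_A^{(n)}}_{G^{(n)}}\le 2R_n)\le f_n$; * fast thermalization: $\frac12\sum_{y}\big|\mathbf P(X^{(n),x}_{R_n}=y)-\mathbf P(X^{(n),x'}_{R_n}=y)\big|\le d_n$ for all $x,x'\in B_\alpha^{(n)}$, where $X^{(n),x}$ is the chain started from $x$; * fast recurrence: $\sup_{x\in\mathcal X^{(n)}}\mathbf P(\tau^{x}_{B_\alpha^{(n)}\cup G^{(n)}}>R_n)<r_n$; and assume that $f_n,r_n,d_n\to0$ as $n\to\infty$. Then $0<\mathbf E[\tau^{\pi_A^{(n)}}_{G^{(n)}}]<\infty$ for every $n$ and, as $n\to\infty$, $$\tau^{\pi_A^{(n)}}_{G^{(n)}}\big/\mathbf E[\tau^{\pi_A^{(n)}}_{G^{(n)}}]\ \xrightarrow{\ \mathcal L\ }\ \mathcal E(1),$$ where $\mathcal E(1)$ is an exponential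 random variable with mean one. Furthermore, for any probability measures $\mu^{(n)}$ on $\mathcal X^{(n)}$ with support contained in $B_\alpha^{(n)}$, one has $0<\mathbf E[\tau^{\mu^{(n)}}_{G^{(n)}}]<\infty$ for every $n$ and $$\tau^{\mu^{(n)}}_{G^{(n)}}\big/\mathbf E[\tau^{\mu^{(n)}}_{G^{(n)}}]\ \xrightarrow{\ \mathcal L\ }\ \mathcal E(1).$$ -/

import Mathlib

open MeasureTheory ProbabilityTheory Filter Topology
open scoped NNReal ENNReal

namespace Metastability

/-- An irreducible continuous time Markov chain on a finite state space: its matrix of transition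
rates `Q` and its invariant probability vector `π`. -/
structure IrreducibleChain (S : Type*) [Fintype S] where
  /-- the matrix of transition rates -/
  Q : Matrix S S ℝ
  rate_nonneg : ∀ x y, x ≠ y → 0 ≤ Q x y
  row_sum : ∀ x, ∑ y, Q x y = 0
  irreducible : ∀ x y, Relation.ReflTransGen (fun a b => 0 < Q a b) x y
  /-- the invariant probability measure -/
  π : stdSimplex ℝ S
  invariant : ∀ y, ∑ x, π.1 x * Q x y = 0

/-- A continuous time Markov chain with transition rates `Q`: a process with right-continuous paths
in the finite discrete space `S` and, for each starting state `x`, a probability `P x` under which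
the finite-dimensional distributions are those given by the semigroup `exp (t Q)` started at `x`. -/
structure MarkovProcess {S : Type*} [Fintype S] [DecidableEq S] (Q : Matrix S S ℝ) where
  /-- the sample space -/
  Ω : Type*
  /-- the events -/
  mΩ : MeasurableSpace Ω
  /-- the position at time `t` -/
  X : ℝ≥0 → Ω → S
  /-- the law of the process started at `x` -/
  P : S → Measure Ω
  isProb : ∀ x, IsProbabilityMeasure (P x)
  measurableSet_eq : ∀ t y, MeasurableSet {ω | X t ω = y}
  rightContinuous : ∀ ω t, ∀ᶠ s in 𝓝[>] t, X s ω = X t ω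
  fdd : ∀ (x : S) (k : ℕ) (t : Fin (k + 1) → ℝ≥0) (y : Fin (k + 1) → S), Monotone t →
    (P x).real {ω | ∀ i, X (t i) ω = y i} =
      NormedSpace.exp ((t 0 : ℝ) • Q) x (y 0) *
        ∏ i : Fin k, NormedSpace.exp (((t i.succ : ℝ) - (t i.castSucc : ℝ)) • Q)
          (y i.castSucc) (y i.succ)

attribute [instance] MarkovProcess.mΩ MarkovProcess.isProb

section Hitting

variable {S : Type*} [Fintype S] [DecidableEq S] {Q : Matrix S S ℝ}

/-- The law of the process with initial distribution `ν`, i.e. `∑ x, ν x • P x`. -/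
noncomputable def MarkovProcess.law (Y : MarkovProcess Q) (ν : stdSimplex ℝ S) : Measure Y.Ω :=
  ∑ x, ENNReal.ofReal (ν.1 x) • Y.P x

instance (Y : MarkovProcess Q) (ν : stdSimplex ℝ S) : IsProbabilityMeasure (Y.law ν) := by
  constructor
  simp only [MarkovProcess.law, Measure.coe_finsetSum, Finset.sum_apply, Measure.smul_apply,
    measure_univ, smul_eq_mul, mul_one]
  rw [← ENNReal.ofReal_sum_of_nonneg (fun x _ => ν.2.1 x), ν.2.2, ENNReal.ofReal_one]

/-- The first hitting time `inf {t ≥ 0 : X t ∈ K}`, equal to `∞` if `K` is never visited. -/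
noncomputable def MarkovProcess.hit (Y : MarkovProcess Q) (K : Set S) (ω : Y.Ω) : ℝ≥0∞ :=
  ⨅ (t : ℝ≥0) (_ : Y.X t ω ∈ K), (t : ℝ≥0∞)

/-- The expected hitting time of `K` when the initial distribution is `ν`. -/
noncomputable def MarkovProcess.meanHit (Y : MarkovProcess Q) (K : Set S) (ν : stdSimplex ℝ S) :
    ℝ≥0∞ :=
  ∫⁻ ω, Y.hit K ω ∂(Y.law ν)

/-- The total variation distance between the distributions at time `t` of the processes started
at `x` and at `x'`. -/
noncomputable def MarkovProcess.tvDist (Y : MarkovProcess Q) (t : ℝ≥0) (x x' : S) : ℝ :=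
  (1 / 2) * ∑ y, |(Y.P x).real {ω | Y.X t ω = y} - (Y.P x').real {ω | Y.X t ω = y}|

end Hitting

namespace IrreducibleChain

variable {S : Type*} [Fintype S]

/-- The transition rates `π(y) Q(y,x) / π(x)` of the time-reversed chain. -/
noncomputable def reversedQ (M : IrreducibleChain S) : Matrix S S ℝ :=
  Matrix.of fun x y => M.π.1 y * M.Q y x / M.π.1 x

theorem π_pos (M : IrreducibleChain S) (x : S) : 0 < M.π.1 x := by
  by_contra hx
  have hx0 : M.π.1 x = 0 := le_antisymm (not_lt.1 hx) (M.π.2.1 x)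
  have key : ∀ z, Relation.ReflTransGen (fun a b => 0 < M.Q a b) z x → M.π.1 z = 0 := by
    intro z hz
    induction hz using Relation.ReflTransGen.head_induction_on with
    | refl => exact hx0
    | @head a c hac _ hc =>
      have hnn : ∀ w ∈ Finset.univ, 0 ≤ M.π.1 w * M.Q w c := by
        intro w _
        by_cases hwc : w = c
        · rw [hwc, hc, zero_mul]
        · exact mul_nonneg (M.π.2.1 w) (M.rate_nonneg w c hwc)
      have h0 := (Finset.sum_eq_zero_iff_of_nonneg hnn).1 (M.invariant c) a (Finset.mem_univ a)
      exact (mul_eq_zero.1 h0).resolve_right hac.ne'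
  have hsum := M.π.2.2
  rw [Finset.sum_eq_zero (fun z _ => key z (M.irreducible z x))] at hsum
  exact zero_ne_one hsum

/-- The invariant measure restricted to `A`: `π_A(x) = π(x) 1_A(x) / π(A)`. -/
noncomputable def piRestrict (M : IrreducibleChain S) (A : Set S) (hA : A.Nonempty) :
    stdSimplex ℝ S :=
  ⟨fun x => A.indicator M.π.1 x / ∑ y, A.indicator M.π.1 y, by
    have hnn : ∀ y, 0 ≤ A.indicator M.π.1 y := Set.indicator_nonneg fun y _ => M.π.2.1 y
    refine ⟨fun x => div_nonneg (hnn x) (Finset.sum_nonneg fun y _ => hnn y), ?_⟩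
    obtain ⟨a, ha⟩ := hA
    have hpos : 0 < ∑ y, A.indicator M.π.1 y :=
      Finset.sum_pos' (fun y _ => hnn y)
        ⟨a, Finset.mem_univ a, by rw [Set.indicator_of_mem ha]; exact M.π_pos a⟩
    rw [← Finset.sum_div, div_self hpos.ne']⟩

end IrreducibleChain

section Hypotheses

variable {S : Type*} [Fintype S] [DecidableEq S] {M : IrreducibleChain S}

/-- The basin `B_α`: the states `x` of `A` from which the average of the probabilities that the
chain and the time-reversed chain hit `G = Aᶜ` within time `2R` is at most `f ^ α`. -/
def basin (Y : MarkovProcess M.Q) (Y' : MarkovProcess M.reversedQ) (A : Set S) (α R f : ℝ) :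
    Set S :=
  {x | x ∈ A ∧ (1 / 2) * ((Y.P x).real {ω | Y.hit Aᶜ ω ≤ ENNReal.ofReal (2 * R)} +
    (Y'.P x).real {ω | Y'.hit Aᶜ ω ≤ ENNReal.ofReal (2 * R)}) ≤ f ^ α}

/-- The hypothesis `Hp.G(R,d,f,r)` for the trap `A`, with `G = Aᶜ`. -/
structure HpG (Y : MarkovProcess M.Q) (Y' : MarkovProcess M.reversedQ) (A : Set S)
    (hA : A.Nonempty) (α R d f r : ℝ) : Prop where
  R_gt : 1 < R
  d_mem : d ∈ Set.Ioo (0 : ℝ) 1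
  f_mem : f ∈ Set.Ioo (0 : ℝ) 1
  r_mem : r ∈ Set.Ioo (0 : ℝ) 1
  /-- slow escape `E(R,f)` -/
  slow_escape :
    (Y.law (M.piRestrict A hA)).real {ω | Y.hit Aᶜ ω ≤ ENNReal.ofReal (2 * R)} ≤ f
  /-- fast thermalization `T(R,d)` in the basin -/
  thermalization : ∀ x ∈ basin Y Y' A α R f, ∀ x' ∈ basin Y Y' A α R f,
    Y.tvDist R.toNNReal x x' ≤ d
  /-- fast recurrence `Rc(R,r)` to the basin or `G` -/
  recurrence : ∀ x,
    (Y.P x).real {ω | ENNReal.ofReal R < Y.hit (basin Y Y' A α R f ∪ Aᶜ) ω} < r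

end Hypotheses

instance : IsProbabilityMeasure (expMeasure 1) := isProbabilityMeasure_expMeasure one_pos

/-- The hitting times of `K n`, with initial distributions `ν n`, have means in `(0, ∞)`, and
divided by their means they converge in law to an exponential variable of mean one. -/
def RescaledHitTendstoExp {S : ℕ → Type*} [∀ n, Fintype (S n)] [∀ n, DecidableEq (S n)]
    {Q : ∀ n, Matrix (S n) (S n) ℝ} (Y : ∀ n, MarkovProcess (Q n)) (K : ∀ n, Set (S n))
    (ν : ∀ n, stdSimplex ℝ (S n)) : Prop :=
  (∀ n, 0 < (Y n).meanHit (K n) (ν n) ∧ (Y n).meanHit (K n) (ν n) < ∞) ∧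
  TendstoInDistribution
    (fun n ω => ((Y n).hit (K n) ω / (Y n).meanHit (K n) (ν n)).toReal) atTop
    (id : ℝ → ℝ) (fun n => (Y n).law (ν n)) (expMeasure 1)

end Metastability

namespace Metastability

/-! Let φ(t) be the probability that the chain started from `π_A` is still in the trap at time t.
The exit time is nearly exponential because φ is nearly multiplicative, with an error of order η =
`mixingError`, which tends to 0.

By time reversal, the average in the definition of the basin has `π_A`-mean equal to the escape
probability, so Markov's inequality gives the complement of the basin `π_A`-mass at most f^(1-α).
From a basin state the trap is kept up to time R with probability at least 1 - 2f^α, and by then the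
starting point is forgotten up to d. Hence all basin states have the survival function φ up to η
(`HpG.abs_surv_sub_le`). The mass surviving from `π_A` at time t is dominated by `π_A`, hence lies
in the basin up to f^(1-α); restarting there gives |φ(t+s) - φ(t)φ(s)| ≤ 2η
(`HpG.abs_survLaw_add_sub_mul_le`).

Choose T with φ(T) → 1/e (`exists_scale_of_almost_mul`). Near multiplicativity gives φ(uT) → e^(-u)
for rational u, and monotonicity for all u (`tendsto_exp_of_almost_mul`). To replace T by the mean,
fast recurrence bounds survival up to 2T by 1/2 from every state, eventually in n. Iteration gives a
geometric tail uniform in n, and dominated convergence yields mean/T → 1 (`tendsto_tail_mul_mean`).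
A law on the basin has survival function within η of φ, so the same argument applies to it.

A process is given only through its finite-dimensional distributions and right-continuity. The
Markov property of the killed process, its duality under reversal and the recurrence estimate are
therefore proved on dyadic grids and passed to the limit (`tendsto_killed`). -/

theorem measureReal_eq_sum_fiber {Ω ι : Type*} [MeasurableSpace Ω] [Fintype ι] (μ : Measure Ω)
    [IsFiniteMeasure μ] (g : Ω → ι) (hg : ∀ i, MeasurableSet {ω | g ω = i}) {s : Set Ω}
    (hs : MeasurableSet s) : μ.real s = ∑ i, μ.real (s ∩ {ω | g ω = i}) := by
  rw [← measureReal_biUnion_finset]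
  · congr 1
    ext ω
    simp
  · intro i _ j _ hij
    refine Set.disjoint_left.2 fun ω h h' => hij (h.2.symm.trans h'.2)
  · exact fun i _ => hs.inter (hg i)

/-! ### Hitting times and the process killed at finitely many times -/

namespace MarkovProcess

variable {S : Type*} [Fintype S] [DecidableEq S] {Q : Matrix S S ℝ} (Y : MarkovProcess Q)

theorem measurableSet_mem (t : ℝ≥0) (K : Set S) : MeasurableSet {ω | Y.X t ω ∈ K} := by
  classical
  have : {ω | Y.X t ω ∈ K} = ⋃ y ∈ K, {ω | Y.X t ω = y} := by ext; simp
  rw [this]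
  exact MeasurableSet.biUnion (Set.to_countable K) fun y _ => Y.measurableSet_eq t y

/-- Right-continuity makes the inequality strict: a path outside `K` at time `t` stays outside for a
short while after `t`. -/
theorem lt_hit_iff (K : Set S) (t : ℝ≥0) (ω : Y.Ω) :
    (t : ℝ≥0∞) < Y.hit K ω ↔ ∀ s ≤ t, Y.X s ω ∉ K := by
  constructor
  · intro h s hs hK
    have : Y.hit K ω ≤ s := iInf₂_le s hK
    exact absurd (h.trans_le this) (not_lt.2 (by exact_mod_cast hs))
  · intro h
    obtain ⟨u, hu, hut⟩ := (mem_nhdsGT_iff_exists_Ioo_subset' (a := t) (u' := t + 1)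
      (show t < t + 1 by simp)).1 (Y.rightContinuous ω t)
    have hu' : t < u := hu
    refine (show (t : ℝ≥0∞) < u by exact_mod_cast hu').trans_le ?_
    refine le_iInf₂ fun s hs => ?_
    by_contra hsu
    have hsu : s < u := by exact_mod_cast not_le.1 hsu
    rcases le_or_gt s t with hst | hst
    · exact h s hst hs
    · have := hut ⟨hst, hsu⟩
      simp only [Set.mem_ofPred_eq] at this
      rw [this] at hs
      exact h t le_rfl hs

/-- The kernel of the process killed on `K`: `P x (τ_K > t, X_t = y)`. -/
noncomputable def killed (K : Set S) (t : ℝ≥0) : Matrix S S ℝ :=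
  Matrix.of fun x y => (Y.P x).real {ω | (t : ℝ≥0∞) < Y.hit K ω ∧ Y.X t ω = y}

open Classical in
/-- The projection on the complement of `K`. -/
noncomputable def proj (K : Set S) : Matrix S S ℝ :=
  Matrix.diagonal fun x => if x ∈ K then 0 else 1

theorem prob_eq (x y : S) (t : ℝ≥0) :
    (Y.P x).real {ω | Y.X t ω = y} = NormedSpace.exp ((t : ℝ) • Q) x y := by
  have := Y.fdd x 0 (fun _ => t) (fun _ => y) monotone_const
  simpa using this

/-- The kernel of the process observed at times `t 0, …, t N` and killed on `K`. -/
noncomputable def killedSkeleton (K : Set S) (t : ℕ → ℝ≥0) (N : ℕ) : Matrix S S ℝ :=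
  Matrix.of fun x y => (Y.P x).real {ω | (∀ i ≤ N, Y.X (t i) ω ∉ K) ∧ Y.X (t N) ω = y}

theorem measurableSet_skeleton (K : Set S) (t : ℕ → ℝ≥0) (N : ℕ) :
    MeasurableSet {ω | ∀ i ≤ N, Y.X (t i) ω ∉ K} := by
  have : {ω | ∀ i ≤ N, Y.X (t i) ω ∉ K} = ⋂ i ∈ Set.Iic N, {ω | Y.X (t i) ω ∈ Kᶜ} := by
    ext; simp
  rw [this]
  exact MeasurableSet.biInter (Set.to_countable _) fun i _ => Y.measurableSet_mem _ _

theorem measurableSet_skeleton_eq (K : Set S) (t : ℕ → ℝ≥0) (N : ℕ) (y : S) :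
    MeasurableSet {ω | (∀ i ≤ N, Y.X (t i) ω ∉ K) ∧ Y.X (t N) ω = y} :=
  (Y.measurableSet_skeleton K t N).inter (Y.measurableSet_eq _ _)

/-- The Markov property as contained in `fdd`: one more observation contributes one more transition
factor. -/
theorem prob_path_snoc (x y : S) {t : ℕ → ℝ≥0} (ht : Monotone t) (N : ℕ) (w : Fin (N + 1) → S) :
    (Y.P x).real ({ω | ∀ i : Fin (N + 1), Y.X (t i) ω = w i} ∩ {ω | Y.X (t (N + 1)) ω = y}) =
      (Y.P x).real {ω | ∀ i : Fin (N + 1), Y.X (t i) ω = w i} *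
        NormedSpace.exp (((t (N + 1) : ℝ) - t N) • Q) (w (Fin.last N)) y := by
  have h1 := Y.fdd x N (fun i => t i) w (fun i j hij => ht hij)
  have h2 := Y.fdd x (N + 1) (fun i => t i) (Fin.snoc w y) (fun i j hij => ht hij)
  have e : {ω | ∀ i : Fin (N + 1 + 1), Y.X (t i) ω = (Fin.snoc w y : Fin (N + 2) → S) i} =
      {ω | ∀ i : Fin (N + 1), Y.X (t i) ω = w i} ∩ {ω | Y.X (t (N + 1)) ω = y} := by
    ext ω
    simp [Fin.forall_fin_succ']
  have h0 : (Fin.snoc w y : Fin (N + 2) → S) 0 = w 0 := by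
    simp [Fin.snoc]
  rw [e] at h2
  rw [h2, h1, Fin.prod_univ_castSucc, h0, mul_assoc]
  congr 2
  · refine Finset.prod_congr rfl fun i _ => ?_
    rw [← Fin.castSucc_succ, Fin.snoc_castSucc, Fin.snoc_castSucc]
    simp
  · simp

/-- Decompose over the positions `w` at the first `N + 1` times; only paths `w` avoiding `K`
contribute, and each picks up one transition factor. -/
theorem killedSkeleton_succ (K : Set S) {t : ℕ → ℝ≥0} (ht : Monotone t) (N : ℕ) :
    Y.killedSkeleton K t (N + 1) = Y.killedSkeleton K t N *
      (NormedSpace.exp (((t (N + 1) : ℝ) - t N) • Q) * proj K) := by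
  classical
  have hpath : ∀ w : Fin (N + 1) → S,
      MeasurableSet {ω | (fun i : Fin (N + 1) => Y.X (t i) ω) = w} := by
    intro w
    have : {ω | (fun i : Fin (N + 1) => Y.X (t i) ω) = w} =
        ⋂ i : Fin (N + 1), {ω | Y.X (t i) ω = w i} := by ext; simp [funext_iff]
    rw [this]
    exact MeasurableSet.iInter fun i => Y.measurableSet_eq _ _
  have hpe : ∀ w : Fin (N + 1) → S, {ω | (fun i : Fin (N + 1) => Y.X (t i) ω) = w} =
      {ω | ∀ i : Fin (N + 1), Y.X (t i) ω = w i} := by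
    intro w; ext; simp [funext_iff]
  ext x y
  rw [← mul_assoc, proj, Matrix.mul_diagonal, Matrix.mul_apply]
  simp only [killedSkeleton, Matrix.of_apply]
  split_ifs with hy
  · rw [mul_zero]
    convert measureReal_empty
    ext ω
    simp only [Set.mem_ofPred_eq, Set.mem_empty_iff_false, iff_false, not_and]
    intro h h'
    exact h _ le_rfl (h' ▸ hy)
  rw [mul_one, measureReal_eq_sum_fiber (Y.P x) _ hpath
    (Y.measurableSet_skeleton_eq K t (N + 1) y)]
  have hz : ∀ z, (Y.P x).real {ω | (∀ i ≤ N, Y.X (t i) ω ∉ K) ∧ Y.X (t N) ω = z} =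
      ∑ w : Fin (N + 1) → S, if (∀ i, w i ∉ K) ∧ w (Fin.last N) = z then
        (Y.P x).real {ω | ∀ i : Fin (N + 1), Y.X (t i) ω = w i} else 0 := by
    intro z
    rw [measureReal_eq_sum_fiber (Y.P x) _ hpath
      (Y.measurableSet_skeleton_eq K t N z)]
    refine Finset.sum_congr rfl fun w _ => ?_
    rw [hpe]
    split_ifs with hw
    · congr 1
      ext ω
      simp only [Set.mem_inter_iff, Set.mem_ofPred_eq, and_iff_right_iff_imp]
      intro h
      refine ⟨fun i hi => ?_, ?_⟩
      · have := h ⟨i, Nat.lt_succ_of_le hi⟩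
        simp only at this
        rw [this]; exact hw.1 _
      · have := h (Fin.last N)
        simp only [Fin.val_last] at this
        rw [this, hw.2]
    · convert measureReal_empty
      ext ω
      simp only [Set.mem_inter_iff, Set.mem_ofPred_eq, Set.mem_empty_iff_false, iff_false, not_and]
      rintro ⟨h1, h2⟩ h
      refine hw ⟨fun i => ?_, ?_⟩
      · rw [← h i]; exact h1 _ (Nat.le_of_lt_succ i.2)
      · rw [← h (Fin.last N)]; exact h2
  simp_rw [hz, Finset.sum_mul]
  rw [Finset.sum_comm]
  refine Finset.sum_congr rfl fun w _ => ?_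
  rw [hpe]
  by_cases hw : ∀ i, w i ∉ K
  · rw [Finset.sum_eq_single (w (Fin.last N))]
    · rw [if_pos ⟨hw, rfl⟩, ← Y.prob_path_snoc x y ht N w]
      congr 1
      ext ω
      simp only [Set.mem_inter_iff, Set.mem_ofPred_eq]
      constructor
      · rintro ⟨⟨_, h⟩, h'⟩
        exact ⟨h', h⟩
      · rintro ⟨h, h'⟩
        refine ⟨⟨fun i hi => ?_, h'⟩, h⟩
        rcases Nat.lt_or_ge N i with hi' | hi'
        · obtain rfl : i = N + 1 := by omega
          rw [h']; exact hy
        · have := h ⟨i, Nat.lt_succ_of_le hi'⟩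
          simp only at this
          rw [this]; exact hw _
    · intro z _ hz
      rw [if_neg (fun h => hz h.2.symm), zero_mul]
    · simp
  · rw [Finset.sum_eq_zero]
    · convert measureReal_empty
      ext ω
      simp only [Set.mem_inter_iff, Set.mem_ofPred_eq, Set.mem_empty_iff_false, iff_false, not_and]
      rintro ⟨h1, h2⟩ h
      refine hw fun i => ?_
      rw [← h i]; exact h1 _ (by have := i.2; omega)
    · intro z _
      rw [if_neg (fun h => hw h.1), zero_mul]

theorem killedSkeleton_zero (K : Set S) {t : ℕ → ℝ≥0} (ht : t 0 = 0) :
    Y.killedSkeleton K t 0 = proj K := by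
  classical
  ext x y
  simp only [killedSkeleton, Matrix.of_apply, proj, Matrix.diagonal_apply]
  have h0 : (Y.P x).real {ω | Y.X 0 ω = y} = if x = y then 1 else 0 := by
    rw [prob_eq]; simp [Matrix.one_apply]
  by_cases hy : y ∈ K
  · rw [show (if x = y then (if x ∈ K then (0 : ℝ) else 1) else 0) = 0 by
      split_ifs with h1 h2 <;> first | rfl | exact absurd (h1 ▸ hy) h2]
    convert measureReal_empty
    ext ω
    simp only [Set.mem_ofPred_eq, Set.mem_empty_iff_false, iff_false, not_and]
    intro h h'
    exact h 0 le_rfl (h' ▸ hy)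
  · have : {ω | (∀ i ≤ 0, Y.X (t i) ω ∉ K) ∧ Y.X (t 0) ω = y} = {ω | Y.X 0 ω = y} := by
      ext ω
      simp only [Set.mem_ofPred_eq, ht, nonpos_iff_eq_zero, forall_eq, and_iff_right_iff_imp]
      rintro rfl; exact hy
    rw [this, h0]
    split_ifs with h1 h2 <;> first | rfl | exact absurd (h1 ▸ h2) hy

end MarkovProcess
-- Dyadic grids
/-- The grid that cuts `[0, t]` and `[t, t + s]` into `2 ^ n` equal pieces each. -/
noncomputable def dyadicGrid (t s : ℝ≥0) (n i : ℕ) : ℝ≥0 :=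
  (min i (2 ^ n) : ℕ) * (t / 2 ^ n) + (i - 2 ^ n : ℕ) * (s / 2 ^ n)

theorem dyadicGrid_zero (t s : ℝ≥0) (n : ℕ) : dyadicGrid t s n 0 = 0 := by
  simp [dyadicGrid]

theorem monotone_dyadicGrid (t s : ℝ≥0) (n : ℕ) : Monotone (dyadicGrid t s n) := by
  intro i j hij
  unfold dyadicGrid
  gcongr

theorem dyadicGrid_last (t s : ℝ≥0) (n : ℕ) : dyadicGrid t s n (2 ^ n + 2 ^ n) = t + s := by
  have h : (2 : ℝ≥0) ^ n ≠ 0 := by positivity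
  simp [dyadicGrid, mul_div_cancel₀ _ h]

theorem dyadicGrid_succ_two_mul (t s : ℝ≥0) (n i : ℕ) :
    dyadicGrid t s (n + 1) (2 * i) = dyadicGrid t s n i := by
  have h : (2 : ℝ≥0) ^ n ≠ 0 := by positivity
  have h1 : min (2 * i) (2 ^ (n + 1)) = 2 * min i (2 ^ n) := by rw [pow_succ]; omega
  have h2 : 2 * i - 2 ^ (n + 1) = 2 * (i - 2 ^ n) := by rw [pow_succ]; omega
  unfold dyadicGrid
  rw [h1, h2, pow_succ (2 : ℝ≥0)]
  push_cast
  field_simp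

theorem dyadicGrid_sub_of_lt (t s : ℝ≥0) {n i : ℕ} (hi : i < 2 ^ n) :
    (dyadicGrid t s n (i + 1) : ℝ) - dyadicGrid t s n i = t / 2 ^ n := by
  have h1 : min (i + 1) (2 ^ n) = i + 1 := by omega
  have h2 : min i (2 ^ n) = i := by omega
  have h3 : i + 1 - 2 ^ n = 0 := by omega
  have h4 : i - 2 ^ n = 0 := by omega
  simp only [dyadicGrid, h1, h2, h3, h4]
  push_cast
  ring

theorem dyadicGrid_sub_of_le (t s : ℝ≥0) {n i : ℕ} (hi : 2 ^ n ≤ i) :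
    (dyadicGrid t s n (i + 1) : ℝ) - dyadicGrid t s n i = s / 2 ^ n := by
  have h1 : min (i + 1) (2 ^ n) = 2 ^ n := by omega
  have h2 : min i (2 ^ n) = 2 ^ n := by omega
  have h3 : i + 1 - 2 ^ n = (i - 2 ^ n) + 1 := by omega
  simp only [dyadicGrid, h1, h2, h3]
  push_cast
  ring

theorem exists_dyadicGrid_mem_Ioo {t s u v : ℝ≥0} (hu : u < t + s) (huv : u < v) :
    ∃ n, ∃ i ≤ 2 ^ n + 2 ^ n, dyadicGrid t s n i ∈ Set.Ioo u v := by
  obtain ⟨n, hn⟩ : ∃ n : ℕ, (max t s : ℝ) / 2 ^ n < (v : ℝ) - u := by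
    have h : Tendsto (fun n : ℕ => (max t s : ℝ) * (1 / 2) ^ n) atTop (𝓝 ((max t s : ℝ) * 0)) :=
      (tendsto_pow_atTop_nhds_zero_of_lt_one (by norm_num) (by norm_num)).const_mul _
    rw [mul_zero] at h
    obtain ⟨n, hn⟩ := (h.eventually_lt_const (u := (v : ℝ) - u)
      (sub_pos.2 (by exact_mod_cast huv))).exists
    exact ⟨n, by simpa [div_eq_mul_inv] using hn⟩
  have hex : ∃ i, u < dyadicGrid t s n i := ⟨2 ^ n + 2 ^ n, by rwa [dyadicGrid_last]⟩
  classical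
  refine ⟨n, Nat.find hex, Nat.find_min' hex (by rwa [dyadicGrid_last]), Nat.find_spec hex, ?_⟩
  obtain ⟨j, hj⟩ : ∃ j, Nat.find hex = j + 1 := by
    refine Nat.exists_eq_succ_of_ne_zero fun h0 => ?_
    have := Nat.find_spec hex
    rw [h0, dyadicGrid_zero] at this
    exact not_lt_bot this
  have hle : dyadicGrid t s n j ≤ u := not_lt.1 (Nat.find_min hex (by omega))
  have hle' : (dyadicGrid t s n j : ℝ) ≤ u := by exact_mod_cast hle
  rw [hj]
  have key : (dyadicGrid t s n (j + 1) : ℝ) - dyadicGrid t s n j ≤ (max t s : ℝ) / 2 ^ n := by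
    rcases lt_or_ge j (2 ^ n) with h | h
    · rw [dyadicGrid_sub_of_lt t s h]; gcongr; exact le_max_left _ _
    · rw [dyadicGrid_sub_of_le t s h]; gcongr; exact le_max_right _ _
  have : (dyadicGrid t s n (j + 1) : ℝ) < v := by linarith
  exact_mod_cast this

/-! ### The killed semigroup as a limit over dyadic grids -/

namespace MarkovProcess

variable {S : Type*} [Fintype S] [DecidableEq S] {Q : Matrix S S ℝ} (Y : MarkovProcess Q)

/-- By right-continuity a visit to `K` before `t + s` lasts for an interval, which meets a fine
enough grid. A visit exactly at `t + s` is seen because that time is itself a grid point. -/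
theorem lt_hit_iff_dyadicGrid (K : Set S) (t s : ℝ≥0) (ω : Y.Ω) :
    ((t + s : ℝ≥0) : ℝ≥0∞) < Y.hit K ω ↔
      ∀ n, ∀ i ≤ 2 ^ n + 2 ^ n, Y.X (dyadicGrid t s n i) ω ∉ K := by
  rw [lt_hit_iff]
  constructor
  · intro h n i hi
    refine h _ ?_
    rw [← dyadicGrid_last t s n]
    exact monotone_dyadicGrid t s n hi
  · intro h u hu hK
    rcases hu.lt_or_eq with hu | rfl
    · obtain ⟨v, hv, huv⟩ := (mem_nhdsGT_iff_exists_Ioo_subset' (a := u) (u' := u + 1)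
        (show u < u + 1 by simp)).1 (Y.rightContinuous ω u)
      obtain ⟨n, i, hi, hmem⟩ := exists_dyadicGrid_mem_Ioo hu hv
      have := huv hmem
      simp only [Set.mem_ofPred_eq] at this
      exact h n i hi (this ▸ hK)
    · exact h 0 _ le_rfl (by rwa [dyadicGrid_last])

theorem tendsto_killedSkeleton (K : Set S) (t s : ℝ≥0) :
    Tendsto (fun n => Y.killedSkeleton K (dyadicGrid t s n) (2 ^ n + 2 ^ n)) atTop
      (𝓝 (Y.killed K (t + s))) := by
  refine tendsto_pi_nhds.2 fun x => tendsto_pi_nhds.2 fun y => ?_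
  simp only [killedSkeleton, killed, Matrix.of_apply]
  have hanti : Antitone fun n => {ω | (∀ i ≤ 2 ^ n + 2 ^ n, Y.X (dyadicGrid t s n i) ω ∉ K) ∧
      Y.X (dyadicGrid t s n (2 ^ n + 2 ^ n)) ω = y} := by
    refine antitone_nat_of_succ_le fun n ω h => ?_
    simp only [Set.mem_ofPred_eq, dyadicGrid_last] at h ⊢
    refine ⟨fun i hi => ?_, h.2⟩
    rw [← dyadicGrid_succ_two_mul]
    exact h.1 _ (by rw [pow_succ]; omega)
  have hlim := tendsto_measure_iInter_atTop (μ := Y.P x)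
    (fun n => (Y.measurableSet_skeleton_eq K (dyadicGrid t s n) (2 ^ n + 2 ^ n) y).nullMeasurableSet)
    hanti ⟨0, measure_ne_top _ _⟩
  have hE : (⋂ n, {ω | (∀ i ≤ 2 ^ n + 2 ^ n, Y.X (dyadicGrid t s n i) ω ∉ K) ∧
      Y.X (dyadicGrid t s n (2 ^ n + 2 ^ n)) ω = y}) =
      {ω | ((t + s : ℝ≥0) : ℝ≥0∞) < Y.hit K ω ∧ Y.X (t + s) ω = y} := by
    ext ω
    simp only [Set.mem_iInter, Set.mem_ofPred_eq, lt_hit_iff_dyadicGrid, dyadicGrid_last]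
    exact ⟨fun h => ⟨fun n => (h n).1, (h 0).2⟩, fun h n => ⟨h.1 n, h.2⟩⟩
  rw [hE] at hlim
  exact (ENNReal.tendsto_toReal (measure_ne_top _ _)).comp hlim

theorem proj_mul_proj (K : Set S) : proj K * proj K = proj K := by
  simp [proj, Matrix.diagonal_mul_diagonal]

theorem proj_mul_proj_pow (K : Set S) (N : ℕ) : proj K * proj K ^ N = proj K := by
  induction N with
  | zero => simp
  | succ N ih => rw [pow_succ, ← mul_assoc, ih, proj_mul_proj]

/-- Since `t` is a grid point, the product splits into a factor for `t` and one for `s`; this is the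
source of the semigroup property. -/
theorem killedSkeleton_dyadicGrid (K : Set S) (t s : ℝ≥0) (n : ℕ) :
    Y.killedSkeleton K (dyadicGrid t s n) (2 ^ n + 2 ^ n) =
      proj K * (NormedSpace.exp (((t : ℝ) / 2 ^ n) • Q) * proj K) ^ (2 ^ n) *
        (NormedSpace.exp (((s : ℝ) / 2 ^ n) • Q) * proj K) ^ (2 ^ n) := by
  have h1 : ∀ N ≤ 2 ^ n, Y.killedSkeleton K (dyadicGrid t s n) N =
      proj K * (NormedSpace.exp (((t : ℝ) / 2 ^ n) • Q) * proj K) ^ N := by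
    intro N
    induction N with
    | zero => intro _; rw [killedSkeleton_zero _ _ (dyadicGrid_zero t s n), pow_zero, mul_one]
    | succ N ih =>
      intro hN
      rw [killedSkeleton_succ _ _ (monotone_dyadicGrid t s n), ih (by omega),
        dyadicGrid_sub_of_lt t s (by omega), pow_succ]
      simp only [mul_assoc]
  have h2 : ∀ N, Y.killedSkeleton K (dyadicGrid t s n) (2 ^ n + N) =
      proj K * (NormedSpace.exp (((t : ℝ) / 2 ^ n) • Q) * proj K) ^ (2 ^ n) *
        (NormedSpace.exp (((s : ℝ) / 2 ^ n) • Q) * proj K) ^ N := by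
    intro N
    induction N with
    | zero => rw [add_zero, h1 _ le_rfl, pow_zero, mul_one]
    | succ N ih =>
      rw [← add_assoc, killedSkeleton_succ _ _ (monotone_dyadicGrid t s n), ih,
        dyadicGrid_sub_of_le t s (by omega), pow_succ]
      simp only [mul_assoc]
  exact h2 _

/-- The killed kernel is the limit of the kernels that are killed at the dyadic times only. -/
theorem tendsto_killed (K : Set S) (t : ℝ≥0) :
    Tendsto (fun n : ℕ => proj K * (NormedSpace.exp (((t : ℝ) / 2 ^ n) • Q) * proj K) ^ (2 ^ n))
      atTop (𝓝 (Y.killed K t)) := by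
  have h := Y.tendsto_killedSkeleton K t 0
  rw [add_zero] at h
  refine h.congr fun n => ?_
  -- With `s = 0` the second half of the grid does not move, and its factors are idempotent
  -- projections that get absorbed.
  have hpe : (NormedSpace.exp ((((0 : ℝ≥0) : ℝ) / 2 ^ n) • Q) * proj K) = proj K := by
    simp
  obtain ⟨N, hN⟩ : ∃ N, 2 ^ n = N + 1 := ⟨2 ^ n - 1, by have := Nat.one_le_two_pow (n := n); omega⟩
  rw [killedSkeleton_dyadicGrid, hpe, hN, pow_succ (_ * proj K)]
  simp only [mul_assoc, proj_mul_proj_pow]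

theorem killed_add (K : Set S) (t s : ℝ≥0) :
    Y.killed K (t + s) = Y.killed K t * Y.killed K s := by
  refine tendsto_nhds_unique (Y.tendsto_killedSkeleton K t s) ?_
  refine ((Y.tendsto_killed K t).mul (Y.tendsto_killed K s)).congr fun n => ?_
  rw [killedSkeleton_dyadicGrid]
  obtain ⟨N, hN⟩ : ∃ N, 2 ^ n = N + 1 := ⟨2 ^ n - 1, by have := Nat.one_le_two_pow (n := n); omega⟩
  rw [hN, pow_succ (NormedSpace.exp (((t : ℝ) / 2 ^ n) • Q) * proj K)]
  simp only [mul_assoc]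
  rw [← mul_assoc (proj K) (proj K), proj_mul_proj]

theorem measurableSet_lt_hit (K : Set S) (t : ℝ≥0) :
    MeasurableSet {ω | (t : ℝ≥0∞) < Y.hit K ω} := by
  have h : {ω | (t : ℝ≥0∞) < Y.hit K ω} =
      ⋂ n, {ω | ∀ i ≤ 2 ^ n + 2 ^ n, Y.X (dyadicGrid t 0 n i) ω ∉ K} := by
    ext ω
    simpa using Y.lt_hit_iff_dyadicGrid K t 0 ω
  rw [h]
  exact MeasurableSet.iInter fun n => Y.measurableSet_skeleton K _ _

theorem measurable_hit (K : Set S) : Measurable (Y.hit K) := by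
  refine measurable_of_Ioi fun a => ?_
  induction a using ENNReal.recTopCoe with
  | top => simp
  | coe t => exact Y.measurableSet_lt_hit K t

/-! ### Survival probabilities -/

/-- The probability that `K` is not visited up to time `t`. -/
noncomputable def surv (K : Set S) (t : ℝ≥0) (x : S) : ℝ :=
  (Y.P x).real {ω | (t : ℝ≥0∞) < Y.hit K ω}

theorem surv_nonneg (K : Set S) (t : ℝ≥0) (x : S) : 0 ≤ Y.surv K t x := measureReal_nonneg

theorem surv_le_one (K : Set S) (t : ℝ≥0) (x : S) : Y.surv K t x ≤ 1 := measureReal_le_one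

theorem surv_antitone (K : Set S) (x : S) : Antitone fun t => Y.surv K t x := fun s t hst =>
  measureReal_mono fun ω (h : (t : ℝ≥0∞) < Y.hit K ω) =>
    (ENNReal.coe_le_coe.2 hst).trans_lt h

theorem surv_eq_sum (K : Set S) (t : ℝ≥0) (x : S) : Y.surv K t x = ∑ y, Y.killed K t x y :=
  measureReal_eq_sum_fiber (Y.P x) (Y.X t) (Y.measurableSet_eq t) (Y.measurableSet_lt_hit K t)

theorem prob_hit_le (K : Set S) (t : ℝ≥0) (x : S) :
    (Y.P x).real {ω | Y.hit K ω ≤ t} = 1 - Y.surv K t x := by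
  rw [surv, ← probReal_compl_eq_one_sub (Y.measurableSet_lt_hit K t)]
  congr 1
  ext ω
  simp

theorem killed_nonneg (K : Set S) (t : ℝ≥0) (x y : S) : 0 ≤ Y.killed K t x y := measureReal_nonneg

theorem killed_le_exp (K : Set S) (t : ℝ≥0) (x y : S) :
    Y.killed K t x y ≤ NormedSpace.exp ((t : ℝ) • Q) x y := by
  rw [← Y.prob_eq]
  exact measureReal_mono fun ω h => h.2

theorem exp_nonneg (Y : MarkovProcess Q) (t : ℝ≥0) (x y : S) :
    0 ≤ NormedSpace.exp ((t : ℝ) • Q) x y := by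
  rw [← Y.prob_eq]
  exact measureReal_nonneg

theorem sum_exp (Y : MarkovProcess Q) (t : ℝ≥0) (x : S) :
    ∑ y, NormedSpace.exp ((t : ℝ) • Q) x y = 1 := by
  simp_rw [← Y.prob_eq]
  have := measureReal_eq_sum_fiber (Y.P x) (Y.X t) (Y.measurableSet_eq t) MeasurableSet.univ
  simpa using this.symm

theorem killed_of_mem (K : Set S) (t : ℝ≥0) (x : S) {y : S} (hy : y ∈ K) :
    Y.killed K t x y = 0 := by
  simp only [killed, Matrix.of_apply]
  convert measureReal_empty
  ext ω
  simp only [Set.mem_ofPred_eq, Set.mem_empty_iff_false, iff_false, not_and, lt_hit_iff]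
  intro h h'
  exact h t le_rfl (h' ▸ hy)

theorem killed_zero (K : Set S) : Y.killed K 0 = proj K := by
  have h := Y.tendsto_killedSkeleton K 0 0
  rw [add_zero] at h
  refine tendsto_nhds_unique h (tendsto_const_nhds.congr fun n => ?_)
  have hpe : (NormedSpace.exp ((((0 : ℝ≥0) : ℝ) / 2 ^ n) • Q) * proj K) = proj K := by
    simp
  rw [killedSkeleton_dyadicGrid, hpe, proj_mul_proj_pow, proj_mul_proj_pow]

theorem surv_zero {K : Set S} {x : S} (hx : x ∉ K) : Y.surv K 0 x = 1 := by
  rw [surv_eq_sum, killed_zero]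
  simp [proj, Matrix.diagonal_apply, hx]

theorem surv_add (K : Set S) (t s : ℝ≥0) (x : S) :
    Y.surv K (t + s) x = ∑ y, Y.killed K t x y * Y.surv K s y := by
  simp_rw [surv_eq_sum, killed_add, Matrix.mul_apply, Finset.mul_sum]
  rw [Finset.sum_comm]

theorem surv_of_mem {K : Set S} {x : S} (hx : x ∈ K) (t : ℝ≥0) : Y.surv K t x = 0 := by
  have h : Y.surv K 0 x = 0 := by
    rw [surv_eq_sum, killed_zero]
    simp [proj, Matrix.diagonal_apply, hx]
  exact le_antisymm ((Y.surv_antitone K x zero_le).trans h.le) (Y.surv_nonneg K t x)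

theorem surv_add_le_exp (K : Set S) (t s : ℝ≥0) (x : S) :
    Y.surv K (t + s) x ≤ ∑ y, NormedSpace.exp ((t : ℝ) • Q) x y * Y.surv K s y := by
  rw [surv_add]
  exact Finset.sum_le_sum fun y _ =>
    mul_le_mul_of_nonneg_right (Y.killed_le_exp K t x y) (Y.surv_nonneg K s y)

/-- Ignoring `K` before time `t` costs at most the probability of having hit it by then. -/
theorem exp_le_surv_add (K : Set S) (t s : ℝ≥0) (x : S) :
    ∑ y, NormedSpace.exp ((t : ℝ) • Q) x y * Y.surv K s y ≤
      Y.surv K (t + s) x + (1 - Y.surv K t x) := by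
  rw [surv_add, ← Y.sum_exp t x, Y.surv_eq_sum K t x, ← Finset.sum_sub_distrib,
    ← Finset.sum_add_distrib]
  refine Finset.sum_le_sum fun y _ => ?_
  nlinarith [Y.killed_le_exp K t x y, Y.surv_le_one K s y]

theorem surv_geometric {K : Set S} {T : ℝ≥0} {q : ℝ} (h : ∀ x, Y.surv K T x ≤ q) (k : ℕ) (x : S) :
    Y.surv K (k * T) x ≤ q ^ k := by
  have hq : 0 ≤ q := (Y.surv_nonneg K T x).trans (h x)
  induction k with
  | zero => simpa using Y.surv_le_one K 0 x
  | succ k ih =>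
    rw [Nat.cast_succ, add_mul, one_mul, surv_add, pow_succ]
    calc ∑ y, Y.killed K (k * T) x y * Y.surv K T y
        ≤ ∑ y, Y.killed K (k * T) x y * q := Finset.sum_le_sum fun y _ =>
          mul_le_mul_of_nonneg_left (h y) (Y.killed_nonneg _ _ _ _)
      _ = Y.surv K (k * T) x * q := by rw [← Finset.sum_mul, ← surv_eq_sum]
      _ ≤ q ^ k * q := mul_le_mul_of_nonneg_right ih hq

/-- To survive up to time `s + R` the process has to avoid `B ∪ K` up to time `R`, or to survive
for a time `s` from some state of `B`. -/
theorem surv_add_le_of_recurrence (K B : Set S) (s R : ℝ≥0) {C : ℝ} (hC : 0 ≤ C)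
    (hB : ∀ z ∈ B, Y.surv K s z ≤ C) (x : S) :
    Y.surv K (s + R) x ≤ Y.surv (B ∪ K) R x + C := by
  classical
  -- Grid version with mesh `h`, by induction on the number of steps. It replaces the strong Markov
  -- property at the hitting time of `B ∪ K`.
  have step : ∀ (h : ℝ≥0) (j : ℕ) (y : S), Y.surv K (s + j * h) y ≤
      ∑ z, (proj (B ∪ K) * (NormedSpace.exp ((h : ℝ) • Q) * proj (B ∪ K)) ^ j) y z + C := by
    intro h j
    -- From `B ∪ K` the leading projection kills the sum, and `C` alone suffices: surviving longer
    -- than `s` is less likely than surviving up to `s`.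
    have hgood : ∀ (j : ℕ) (y : S), y ∈ B ∪ K → Y.surv K (s + j * h) y ≤
        ∑ z, (proj (B ∪ K) * (NormedSpace.exp ((h : ℝ) • Q) * proj (B ∪ K)) ^ j) y z + C := by
      intro j y hy
      have h0 : ∑ z, (proj (B ∪ K) *
          (NormedSpace.exp ((h : ℝ) • Q) * proj (B ∪ K)) ^ j) y z = 0 := by
        refine Finset.sum_eq_zero fun z _ => ?_
        rw [proj, Matrix.diagonal_mul, if_pos hy, zero_mul]
      rw [h0, zero_add]
      by_cases hyB : y ∈ B
      · exact (Y.surv_antitone K y (by simp)).trans (hB y hyB)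
      · rw [Y.surv_of_mem (hy.resolve_left hyB)]; exact hC
    induction j with
    | zero =>
      intro y
      by_cases hy : y ∈ B ∪ K
      · exact hgood 0 y hy
      · have := Y.surv_le_one K (s + (0 : ℕ) * h) y
        simp only [pow_zero, mul_one, proj, Matrix.diagonal_apply, hy, if_false,
          Finset.sum_ite_eq, Finset.mem_univ, if_true]
        linarith
    | succ j ih =>
      intro y
      by_cases hy : y ∈ B ∪ K
      · exact hgood (j + 1) y hy
      · have e : s + ((j + 1 : ℕ) : ℝ≥0) * h = h + (s + j * h) := by push_cast; ring
        rw [e]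
        refine (Y.surv_add_le_exp K h _ y).trans ?_
        have e2 : ∑ z, (proj (B ∪ K) *
            (NormedSpace.exp ((h : ℝ) • Q) * proj (B ∪ K)) ^ (j + 1)) y z =
            ∑ w, NormedSpace.exp ((h : ℝ) • Q) y w * ∑ z, (proj (B ∪ K) *
            (NormedSpace.exp ((h : ℝ) • Q) * proj (B ∪ K)) ^ j) w z := by
          rw [pow_succ', mul_assoc (NormedSpace.exp _)]
          simp_rw [Finset.mul_sum]
          rw [Finset.sum_comm]
          refine Finset.sum_congr rfl fun z _ => ?_
          rw [proj, Matrix.diagonal_mul, if_neg hy, one_mul, Matrix.mul_apply]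
        rw [e2]
        calc ∑ w, NormedSpace.exp ((h : ℝ) • Q) y w * Y.surv K (s + j * h) w
            ≤ ∑ w, NormedSpace.exp ((h : ℝ) • Q) y w * (∑ z, (proj (B ∪ K) *
              (NormedSpace.exp ((h : ℝ) • Q) * proj (B ∪ K)) ^ j) w z + C) :=
              Finset.sum_le_sum fun w _ => mul_le_mul_of_nonneg_left (ih w) (Y.exp_nonneg h y w)
          _ = _ := by
            simp_rw [mul_add]
            rw [Finset.sum_add_distrib, ← Finset.sum_mul, Y.sum_exp, one_mul]
  have hlim : Tendsto (fun n : ℕ => ∑ z, (proj (B ∪ K) *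
      (NormedSpace.exp (((R : ℝ) / 2 ^ n) • Q) * proj (B ∪ K)) ^ (2 ^ n)) x z + C) atTop
      (𝓝 (Y.surv (B ∪ K) R x + C)) := by
    refine Tendsto.add_const C ?_
    rw [surv_eq_sum]
    exact tendsto_finsetSum _ fun z _ =>
      tendsto_pi_nhds.1 (tendsto_pi_nhds.1 (Y.tendsto_killed (B ∪ K) R) x) z
  refine ge_of_tendsto' hlim fun n => ?_
  have := step (R / 2 ^ n) (2 ^ n) x
  have h2 : ((2 ^ n : ℕ) : ℝ≥0) * (R / 2 ^ n) = R := by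
    push_cast
    exact mul_div_cancel₀ _ (by positivity)
  rw [h2] at this
  simpa using this

theorem law_real_apply (ν : stdSimplex ℝ S) (s : Set Y.Ω) :
    (Y.law ν).real s = ∑ x, ν.1 x * (Y.P x).real s := by
  simp only [law, measureReal_def, Measure.coe_finsetSum, Finset.sum_apply, Measure.smul_apply,
    smul_eq_mul]
  rw [ENNReal.toReal_sum fun x _ => ENNReal.mul_ne_top ENNReal.ofReal_ne_top (measure_ne_top _ _)]
  refine Finset.sum_congr rfl fun x _ => ?_
  rw [ENNReal.toReal_mul, ENNReal.toReal_ofReal (ν.2.1 x)]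

end MarkovProcess

open MarkovProcess

/-! ### Duality under time reversal -/

section Reversal

variable {S : Type*} [Fintype S] [DecidableEq S] {M : IrreducibleChain S}

/-- `reversedQ` is the adjoint of `Q` with respect to `π`, a conjugate of the transpose, and
conjugation and transposition commute with the exponential. -/
theorem diagonal_mul_exp_reversedQ (t : ℝ) :
    Matrix.diagonal M.π.1 * NormedSpace.exp (t • M.reversedQ) =
      (NormedSpace.exp (t • M.Q)).transpose * Matrix.diagonal M.π.1 := by
  have hu : IsUnit (Matrix.diagonal M.π.1) := by
    rw [Matrix.isUnit_iff_isUnit_det, Matrix.det_diagonal, isUnit_iff_ne_zero]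
    exact Finset.prod_ne_zero_iff.2 fun x _ => (M.π_pos x).ne'
  have hu' := (Matrix.isUnit_iff_isUnit_det _).1 hu
  have h1 : Matrix.diagonal M.π.1 * (t • M.reversedQ) =
      (t • M.Q).transpose * Matrix.diagonal M.π.1 := by
    ext x y
    rw [Matrix.diagonal_mul, Matrix.mul_diagonal]
    simp only [IrreducibleChain.reversedQ, Matrix.smul_apply, Matrix.of_apply, smul_eq_mul,
      Matrix.transpose_apply]
    have := (M.π_pos x).ne'
    field_simp
  have h2 : t • M.reversedQ =
      (Matrix.diagonal M.π.1)⁻¹ * (t • M.Q).transpose * Matrix.diagonal M.π.1 := by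
    rw [mul_assoc, ← h1, ← mul_assoc, Matrix.nonsing_inv_mul _ hu', one_mul]
  rw [h2, Matrix.exp_conj' _ _ hu, ← mul_assoc, ← mul_assoc, Matrix.mul_nonsing_inv _ hu', one_mul,
    Matrix.exp_transpose]

/-- The duality of the semigroups passes to products interlaced with `proj K`, which commutes with
the diagonal of `π`, and then to the dyadic limit. -/
theorem killed_reversed (Y : MarkovProcess M.Q) (Y' : MarkovProcess M.reversedQ) (K : Set S)
    (t : ℝ≥0) (x y : S) :
    M.π.1 x * Y'.killed K t x y = M.π.1 y * Y.killed K t y x := by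
  have hD : (proj K).transpose = (proj K) := Matrix.diagonal_transpose _
  have hc : Matrix.diagonal M.π.1 * proj K = proj K * Matrix.diagonal M.π.1 := by
    simp only [proj, Matrix.diagonal_mul_diagonal, mul_comm]
  have hpow : ∀ (A : Matrix S S ℝ) (N : ℕ),
      (proj K * A) ^ N * proj K = proj K * (A * proj K) ^ N := by
    intro A N
    have hs : SemiconjBy (proj K) (A * proj K) (proj K * A) := by
      simp only [SemiconjBy, mul_assoc]
    exact (hs.pow_right N).eq.symm
  have h : Matrix.diagonal M.π.1 * Y'.killed K t =
      (Y.killed K t).transpose * Matrix.diagonal M.π.1 := by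
    refine tendsto_nhds_unique ((Y'.tendsto_killed K t).const_mul _)
      (((continuous_id.matrix_transpose.tendsto _).comp (Y.tendsto_killed K t)).mul_const _ |>.congr
        fun n => ?_)
    have hs : SemiconjBy (Matrix.diagonal M.π.1)
        (NormedSpace.exp (((t : ℝ) / 2 ^ n) • M.reversedQ) * proj K)
        ((NormedSpace.exp (((t : ℝ) / 2 ^ n) • M.Q)).transpose * proj K) := by
      rw [SemiconjBy, ← mul_assoc, diagonal_mul_exp_reversedQ, mul_assoc, hc, mul_assoc]
    simp only [Function.comp_apply, id]
    rw [Matrix.transpose_mul, Matrix.transpose_pow, Matrix.transpose_mul, hD, hpow, ← mul_assoc,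
      hc, mul_assoc, mul_assoc, (hs.pow_right _).eq]
  have := congrFun (congrFun h x) y
  rw [Matrix.diagonal_mul, Matrix.mul_diagonal, Matrix.transpose_apply] at this
  rw [this, mul_comm]

/-- By duality, invariance of `π` under the semigroup says that the reversed semigroup has row sums
one, which holds because it is realised by `Y'`. -/
theorem sum_π_mul_exp (Y' : MarkovProcess M.reversedQ) (t : ℝ≥0) (y : S) :
    ∑ x, M.π.1 x * NormedSpace.exp ((t : ℝ) • M.Q) x y = M.π.1 y := by
  have h : ∀ x, M.π.1 x * NormedSpace.exp ((t : ℝ) • M.Q) x y =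
      M.π.1 y * NormedSpace.exp ((t : ℝ) • M.reversedQ) y x := by
    intro x
    have := congrFun (congrFun (diagonal_mul_exp_reversedQ (M := M) (t : ℝ)) y) x
    rw [Matrix.diagonal_mul, Matrix.mul_diagonal, Matrix.transpose_apply] at this
    rw [this, mul_comm]
  simp_rw [h]
  rw [← Finset.mul_sum, Y'.sum_exp, mul_one]

/-- Started from `π`, the chain and its time reversal have the same probability to survive. -/
theorem sum_π_mul_surv_reversed (Y : MarkovProcess M.Q) (Y' : MarkovProcess M.reversedQ)
    (K : Set S) (t : ℝ≥0) :
    ∑ x, M.π.1 x * Y'.surv K t x = ∑ x, M.π.1 x * Y.surv K t x := by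
  simp_rw [surv_eq_sum, Finset.mul_sum, killed_reversed Y Y']
  exact Finset.sum_comm

end Reversal

section Support

variable {S : Type*} [Fintype S] {M : IrreducibleChain S}

theorem support_piRestrict_subset (A : Set S) (hA : A.Nonempty) :
    Function.support (M.piRestrict A hA).1 ⊆ A := by
  intro x hx
  by_contra h
  refine hx ?_
  simp [IrreducibleChain.piRestrict, h]

theorem sum_indicator_π_pos {A : Set S} (hA : A.Nonempty) : 0 < ∑ y, A.indicator M.π.1 y := by
  obtain ⟨a, ha⟩ := hA
  refine Finset.sum_pos' (fun y _ => Set.indicator_nonneg (fun y _ => M.π.2.1 y) y)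
    ⟨a, Finset.mem_univ a, ?_⟩
  rw [Set.indicator_of_mem ha]
  exact M.π_pos a

end Support

/-! ### Survival from an initial law -/

section SurvLaw

variable {S : Type*} [Fintype S] [DecidableEq S] {M : IrreducibleChain S}

/-- The probability that the process with initial law `ν` does not visit `K` up to time `t`. -/
noncomputable def MarkovProcess.survLaw {Q : Matrix S S ℝ} (Y : MarkovProcess Q) (K : Set S)
    (ν : stdSimplex ℝ S) (t : ℝ≥0) : ℝ :=
  (Y.law ν).real {ω | (t : ℝ≥0∞) < Y.hit K ω}

theorem MarkovProcess.survLaw_eq_sum {Q : Matrix S S ℝ} (Y : MarkovProcess Q) (K : Set S)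
    (ν : stdSimplex ℝ S) (t : ℝ≥0) : Y.survLaw K ν t = ∑ x, ν.1 x * Y.surv K t x :=
  Y.law_real_apply ν _

theorem MarkovProcess.survLaw_nonneg {Q : Matrix S S ℝ} (Y : MarkovProcess Q) (K : Set S)
    (ν : stdSimplex ℝ S) (t : ℝ≥0) : 0 ≤ Y.survLaw K ν t := measureReal_nonneg

theorem MarkovProcess.survLaw_le_one {Q : Matrix S S ℝ} (Y : MarkovProcess Q) (K : Set S)
    (ν : stdSimplex ℝ S) (t : ℝ≥0) : Y.survLaw K ν t ≤ 1 := measureReal_le_one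

theorem MarkovProcess.survLaw_antitone {Q : Matrix S S ℝ} (Y : MarkovProcess Q) (K : Set S)
    (ν : stdSimplex ℝ S) : Antitone (Y.survLaw K ν) := fun s t hst =>
  measureReal_mono fun ω (h : (t : ℝ≥0∞) < Y.hit K ω) =>
    (ENNReal.coe_le_coe.2 hst).trans_lt h

theorem MarkovProcess.survLaw_le {Q : Matrix S S ℝ} (Y : MarkovProcess Q) {K : Set S}
    (ν : stdSimplex ℝ S) {t : ℝ≥0} {C : ℝ} (h : ∀ x, Y.surv K t x ≤ C) : Y.survLaw K ν t ≤ C := by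
  rw [survLaw_eq_sum]
  calc ∑ x, ν.1 x * Y.surv K t x ≤ ∑ x, ν.1 x * C :=
        Finset.sum_le_sum fun x _ => mul_le_mul_of_nonneg_left (h x) (ν.2.1 x)
    _ = C := by rw [← Finset.sum_mul, ν.2.2, one_mul]

theorem MarkovProcess.survLaw_zero {Q : Matrix S S ℝ} (Y : MarkovProcess Q) {K : Set S}
    {ν : stdSimplex ℝ S} (h : Function.support ν.1 ⊆ Kᶜ) : Y.survLaw K ν 0 = 1 := by
  rw [survLaw_eq_sum, ← ν.2.2]
  refine Finset.sum_congr rfl fun x _ => ?_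
  by_cases hx : ν.1 x = 0
  · rw [hx, zero_mul]
  · rw [Y.surv_zero (h hx), mul_one]

theorem survLaw_piRestrict (Y : MarkovProcess M.Q) (A : Set S) (hA : A.Nonempty) (t : ℝ≥0) :
    Y.survLaw Aᶜ (M.piRestrict A hA) t =
      (∑ x, M.π.1 x * Y.surv Aᶜ t x) / ∑ y, A.indicator M.π.1 y := by
  rw [survLaw_eq_sum, Finset.sum_div]
  refine Finset.sum_congr rfl fun x _ => ?_
  change A.indicator M.π.1 x / _ * _ = _
  by_cases hx : x ∈ A
  · rw [Set.indicator_of_mem hx]; ring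
  · rw [Y.surv_of_mem (K := Aᶜ) hx]; simp

theorem sum_piRestrict_mul_surv_reversed (Y : MarkovProcess M.Q)
    (Y' : MarkovProcess M.reversedQ) (A : Set S) (hA : A.Nonempty) (t : ℝ≥0) :
    ∑ x, (M.piRestrict A hA).1 x * Y'.surv Aᶜ t x =
      ∑ x, (M.piRestrict A hA).1 x * Y.surv Aᶜ t x := by
  rw [← survLaw_eq_sum Y, survLaw_piRestrict, ← sum_π_mul_surv_reversed Y Y', Finset.sum_div]
  refine Finset.sum_congr rfl fun x _ => ?_
  change A.indicator M.π.1 x / _ * _ = _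
  by_cases hx : x ∈ A
  · rw [Set.indicator_of_mem hx]; ring
  · rw [Y'.surv_of_mem (K := Aᶜ) hx]; simp

/-- The mass flow of the process killed outside of `A` and started from `π_A` is dominated
by `π_A`. -/
theorem sum_piRestrict_mul_killed_le (Y : MarkovProcess M.Q) (Y' : MarkovProcess M.reversedQ)
    (A : Set S) (hA : A.Nonempty) (t : ℝ≥0) (y : S) :
    ∑ x, (M.piRestrict A hA).1 x * Y.killed Aᶜ t x y ≤ (M.piRestrict A hA).1 y := by
  by_cases hy : y ∈ A
  · have hZ := sum_indicator_π_pos (M := M) hA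
    -- Invariance writes `π_A y` as a flow from all states without killing; restricting the start to
    -- `A` and killing only decrease it.
    have e : (M.piRestrict A hA).1 y = (∑ x, M.π.1 x * NormedSpace.exp ((t : ℝ) • M.Q) x y) /
        ∑ y, A.indicator M.π.1 y := by
      rw [sum_π_mul_exp Y']
      change A.indicator M.π.1 y / _ = _
      rw [Set.indicator_of_mem hy]
    rw [e, Finset.sum_div]
    refine Finset.sum_le_sum fun x _ => ?_
    change A.indicator M.π.1 x / _ * _ ≤ _
    rw [div_mul_eq_mul_div]
    gcongr
    · exact Y.killed_nonneg _ _ _ _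
    · exact M.π.2.1 x
    · exact Set.indicator_le_self' (fun x _ => M.π.2.1 x) x
    · exact Y.killed_le_exp _ _ _ _
  · rw [Finset.sum_eq_zero fun x _ => by rw [Y.killed_of_mem _ _ _ (show y ∈ Aᶜ from hy), mul_zero]]
    exact (M.piRestrict A hA).2.1 y

end SurvLaw

/-! ### Consequences of slow escape, thermalization and recurrence -/

section Estimates

variable {S : Type*} [Fintype S] [DecidableEq S] {M : IrreducibleChain S}
  {Y : MarkovProcess M.Q} {Y' : MarkovProcess M.reversedQ} {A : Set S} {hA : A.Nonempty}
  {α R d f r : ℝ}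

/-- A bound for the influence of the initial state on the law of the exit time. -/
noncomputable def mixingError (α d f : ℝ) : ℝ := 2 * f ^ α + 2 * d + f ^ (1 - α)

open Classical in
-- Markov's inequality for the averaged escape probability, which exceeds f^α on the rest of `A`.
theorem HpG.sum_piRestrict_compl_basin_le (h : HpG Y Y' A hA α R d f r) :
    ∑ x, (if x ∈ basin Y Y' A α R f then 0 else (M.piRestrict A hA).1 x) ≤ f ^ (1 - α) := by
  have hf0 := h.f_mem.1
  have hs := h.slow_escape
  rw [law_real_apply] at hs
  have key : f ^ α * ∑ x, (if x ∈ basin Y Y' A α R f then 0 else (M.piRestrict A hA).1 x) ≤ f := by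
    refine le_trans ?_ hs
    -- Under `π_A` the chain and its reversal escape equally often, so averaging the two does not
    -- change the mean.
    have e : ∑ x, (M.piRestrict A hA).1 x *
        (Y.P x).real {ω | Y.hit Aᶜ ω ≤ ENNReal.ofReal (2 * R)} =
        ∑ x, (M.piRestrict A hA).1 x * ((1 / 2) *
          ((Y.P x).real {ω | Y.hit Aᶜ ω ≤ ENNReal.ofReal (2 * R)} +
          (Y'.P x).real {ω | Y'.hit Aᶜ ω ≤ ENNReal.ofReal (2 * R)})) := by
      have h1 : ∀ x, (M.piRestrict A hA).1 x * ((1 / 2) *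
          ((Y.P x).real {ω | Y.hit Aᶜ ω ≤ ENNReal.ofReal (2 * R)} +
          (Y'.P x).real {ω | Y'.hit Aᶜ ω ≤ ENNReal.ofReal (2 * R)})) =
          (M.piRestrict A hA).1 x -
          ((M.piRestrict A hA).1 x * Y.surv Aᶜ (2 * R).toNNReal x) / 2 -
          ((M.piRestrict A hA).1 x * Y'.surv Aᶜ (2 * R).toNNReal x) / 2 := by
        intro x
        simp only [ENNReal.ofReal, prob_hit_le]
        ring
      simp_rw [h1]
      rw [Finset.sum_sub_distrib, Finset.sum_sub_distrib, ← Finset.sum_div, ← Finset.sum_div,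
        sum_piRestrict_mul_surv_reversed Y Y']
      simp only [ENNReal.ofReal, prob_hit_le, mul_sub, mul_one, Finset.sum_sub_distrib]
      ring
    rw [e, Finset.mul_sum]
    refine Finset.sum_le_sum fun x _ => ?_
    have hp := (M.piRestrict A hA).2.1 x
    have hnn : 0 ≤ (1 / 2) *
          ((Y.P x).real {ω | Y.hit Aᶜ ω ≤ ENNReal.ofReal (2 * R)} +
          (Y'.P x).real {ω | Y'.hit Aᶜ ω ≤ ENNReal.ofReal (2 * R)}) := by positivity
    split_ifs with hx
    · rw [mul_zero]
      exact mul_nonneg hp hnn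
    · rw [mul_comm]
      by_cases hxA : x ∈ A
      · refine mul_le_mul_of_nonneg_left ?_ hp
        by_contra hlt
        exact hx ⟨hxA, (not_le.1 hlt).le⟩
      · have h0 : (M.piRestrict A hA).1 x = 0 := by
          by_contra hne
          exact hxA (support_piRestrict_subset A hA hne)
        rw [h0, zero_mul, zero_mul]
  rw [Real.rpow_sub hf0, Real.rpow_one, le_div_iff₀ (Real.rpow_pos_of_pos hf0 _), mul_comm]
  exact key

/-- The factor 2 arises because the basin bounds only the half-sum of the two escape probabilities.
-/
theorem one_sub_le_surv_of_mem_basin {x : S} (hx : x ∈ basin Y Y' A α R f) {s : ℝ≥0}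
    (hs : s ≤ (2 * R).toNNReal) : 1 - 2 * f ^ α ≤ Y.surv Aᶜ s x := by
  have h1 := hx.2
  have h2 : 0 ≤ (Y'.P x).real {ω | Y'.hit Aᶜ ω ≤ ENNReal.ofReal (2 * R)} := measureReal_nonneg
  have h3 := Y.prob_hit_le Aᶜ (2 * R).toNNReal x
  have h4 := Y.surv_antitone Aᶜ x hs
  simp only [ENNReal.ofReal] at *
  rw [h3] at h1
  linarith

/-- Up to time R both survival probabilities are near one. Beyond R, killing before R is ignored at
cost 2f^α, and the laws at time R are compared in ℓ¹, that is twice the total variation distance. -/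
theorem HpG.surv_le_surv_add (h : HpG Y Y' A hA α R d f r) {x x' : S}
    (hx : x ∈ basin Y Y' A α R f) (hx' : x' ∈ basin Y Y' A α R f) (s : ℝ≥0) :
    Y.surv Aᶜ s x ≤ Y.surv Aᶜ s x' + (2 * f ^ α + 2 * d) := by
  have hR : R.toNNReal ≤ (2 * R).toNNReal := Real.toNNReal_le_toNNReal (by linarith [h.R_gt])
  rcases le_total s R.toNNReal with hs | hs
  · have := one_sub_le_surv_of_mem_basin hx' (hs.trans hR)
    linarith [Y.surv_le_one Aᶜ s x, h.d_mem.1]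
  · obtain ⟨u, rfl⟩ := exists_add_of_le hs
    have h1 := Y.surv_add_le_exp Aᶜ R.toNNReal u x
    have h2 := Y.exp_le_surv_add Aᶜ R.toNNReal u x'
    have h3 := one_sub_le_surv_of_mem_basin hx' hR
    have h4 := h.thermalization x hx x' hx'
    simp only [tvDist, prob_eq] at h4
    have h5 : ∑ y, NormedSpace.exp ((R.toNNReal : ℝ) • M.Q) x y * Y.surv Aᶜ u y -
        ∑ y, NormedSpace.exp ((R.toNNReal : ℝ) • M.Q) x' y * Y.surv Aᶜ u y ≤
        ∑ y, |NormedSpace.exp ((R.toNNReal : ℝ) • M.Q) x y -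
          NormedSpace.exp ((R.toNNReal : ℝ) • M.Q) x' y| := by
      rw [← Finset.sum_sub_distrib]
      refine Finset.sum_le_sum fun y _ => ?_
      rw [← sub_mul]
      refine (le_abs_self _).trans ?_
      rw [abs_mul, abs_of_nonneg (Y.surv_nonneg _ _ _)]
      exact mul_le_of_le_one_right (abs_nonneg _) (Y.surv_le_one _ _ _)
    linarith

theorem HpG.mixingError_nonneg (h : HpG Y Y' A hA α R d f r) : 0 ≤ mixingError α d f := by
  have := h.f_mem.1
  have := h.d_mem.1
  unfold mixingError
  positivity

/-- Average the comparison between basin states over `π_A`, bounding the difference by one off the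
basin. -/
theorem HpG.abs_surv_sub_le (h : HpG Y Y' A hA α R d f r) {x : S}
    (hx : x ∈ basin Y Y' A α R f) (s : ℝ≥0) :
    |Y.surv Aᶜ s x - Y.survLaw Aᶜ (M.piRestrict A hA) s| ≤ mixingError α d f := by
  classical
  have hf0 := h.f_mem.1
  have hd0 := h.d_mem.1
  have hfa : 0 < f ^ α := Real.rpow_pos_of_pos hf0 _
  have e : Y.surv Aᶜ s x - Y.survLaw Aᶜ (M.piRestrict A hA) s =
      ∑ x', (M.piRestrict A hA).1 x' * (Y.surv Aᶜ s x - Y.surv Aᶜ s x') := by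
    simp_rw [mul_sub]
    rw [Finset.sum_sub_distrib, ← Finset.sum_mul, (M.piRestrict A hA).2.2, one_mul,
      survLaw_eq_sum]
  rw [e]
  refine (Finset.abs_sum_le_sum_abs _ _).trans ?_
  calc ∑ x', |(M.piRestrict A hA).1 x' * (Y.surv Aᶜ s x - Y.surv Aᶜ s x')|
      ≤ ∑ x', ((M.piRestrict A hA).1 x' * (2 * f ^ α + 2 * d) +
          (if x' ∈ basin Y Y' A α R f then 0 else (M.piRestrict A hA).1 x')) := by
        refine Finset.sum_le_sum fun x' _ => ?_
        have hp := (M.piRestrict A hA).2.1 x'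
        rw [abs_mul, abs_of_nonneg hp]
        split_ifs with hx'
        · rw [add_zero]
          refine mul_le_mul_of_nonneg_left (abs_le.2 ⟨?_, ?_⟩) hp
          · linarith [h.surv_le_surv_add hx' hx s]
          · linarith [h.surv_le_surv_add hx hx' s]
        · have h1 : |Y.surv Aᶜ s x - Y.surv Aᶜ s x'| ≤ 1 := abs_le.2
            ⟨by linarith [Y.surv_nonneg Aᶜ s x, Y.surv_le_one Aᶜ s x'],
              by linarith [Y.surv_le_one Aᶜ s x, Y.surv_nonneg Aᶜ s x']⟩
          have h2 := mul_le_mul_of_nonneg_left h1 hp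
          have h3 : 0 ≤ (M.piRestrict A hA).1 x' * (2 * f ^ α + 2 * d) :=
            mul_nonneg hp (by positivity)
          linarith
    _ ≤ mixingError α d f := by
        rw [Finset.sum_add_distrib, ← Finset.sum_mul, (M.piRestrict A hA).2.2, one_mul]
        unfold mixingError
        linarith [h.sum_piRestrict_compl_basin_le]

/-- Up to a small error the exit time from `π_A` has no memory. -/
theorem HpG.abs_survLaw_add_sub_mul_le (h : HpG Y Y' A hA α R d f r) (t s : ℝ≥0) :
    |Y.survLaw Aᶜ (M.piRestrict A hA) (t + s) -
      Y.survLaw Aᶜ (M.piRestrict A hA) t * Y.survLaw Aᶜ (M.piRestrict A hA) s| ≤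
      2 * mixingError α d f := by
  classical
  set φ := Y.survLaw Aᶜ (M.piRestrict A hA) with hφ
  -- The unnormalised law at time `t` on survival. Its domination by `π_A` keeps the mass off the
  -- basin small without dividing by φ(t), which may be tiny.
  set w : S → ℝ := fun y => ∑ x, (M.piRestrict A hA).1 x * Y.killed Aᶜ t x y with hw
  have hw0 : ∀ y, 0 ≤ w y := fun y => Finset.sum_nonneg fun x _ =>
    mul_nonneg ((M.piRestrict A hA).2.1 x) (Y.killed_nonneg _ _ _ _)
  have hw1 : ∀ y, w y ≤ (M.piRestrict A hA).1 y := sum_piRestrict_mul_killed_le Y Y' A hA t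
  have hsum : ∑ y, w y = φ t := by
    rw [hφ, survLaw_eq_sum, Finset.sum_comm]
    simp_rw [surv_eq_sum, Finset.mul_sum]
  have hadd : φ (t + s) = ∑ y, w y * Y.surv Aᶜ s y := by
    rw [hφ, survLaw_eq_sum]
    simp_rw [surv_add, hw, Finset.mul_sum, Finset.sum_mul, ← mul_assoc]
    exact Finset.sum_comm
  have e : φ (t + s) - φ t * φ s = ∑ y, w y * (Y.surv Aᶜ s y - φ s) := by
    simp_rw [mul_sub]
    rw [Finset.sum_sub_distrib, ← Finset.sum_mul, hsum, hadd]
  rw [e]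
  refine (Finset.abs_sum_le_sum_abs _ _).trans ?_
  have hη := h.mixingError_nonneg
  calc ∑ y, |w y * (Y.surv Aᶜ s y - φ s)|
      ≤ ∑ y, ((M.piRestrict A hA).1 y * mixingError α d f +
          (if y ∈ basin Y Y' A α R f then 0 else (M.piRestrict A hA).1 y)) := by
        refine Finset.sum_le_sum fun y _ => ?_
        have hp := (M.piRestrict A hA).2.1 y
        rw [abs_mul, abs_of_nonneg (hw0 y)]
        split_ifs with hy
        · rw [add_zero]
          exact mul_le_mul (hw1 y) (h.abs_surv_sub_le hy s) (abs_nonneg _) hp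
        · have h1 : |Y.surv Aᶜ s y - φ s| ≤ 1 := abs_le.2
            ⟨by linarith [Y.surv_nonneg Aᶜ s y, Y.survLaw_le_one Aᶜ (M.piRestrict A hA) s],
              by linarith [Y.surv_le_one Aᶜ s y, Y.survLaw_nonneg Aᶜ (M.piRestrict A hA) s]⟩
          have h2 := mul_le_mul (hw1 y) h1 (abs_nonneg _) hp
          have h3 := mul_nonneg hp hη
          linarith
    _ ≤ 2 * mixingError α d f := by
        rw [Finset.sum_add_distrib, ← Finset.sum_mul, (M.piRestrict A hA).2.2, one_mul]
        have h1 := h.sum_piRestrict_compl_basin_le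
        have h2 : f ^ (1 - α) ≤ mixingError α d f := by
          have := Real.rpow_pos_of_pos h.f_mem.1 α
          have := h.d_mem.1
          unfold mixingError
          linarith
        linarith

theorem HpG.surv_add_le (h : HpG Y Y' A hA α R d f r) (s : ℝ≥0) (x : S) :
    Y.surv Aᶜ (s + R.toNNReal) x ≤
      r + Y.survLaw Aᶜ (M.piRestrict A hA) s + mixingError α d f := by
  have h1 := Y.surv_add_le_of_recurrence Aᶜ (basin Y Y' A α R f) s R.toNNReal
    (C := Y.survLaw Aᶜ (M.piRestrict A hA) s + mixingError α d f)
    (add_nonneg (Y.survLaw_nonneg _ _ _) h.mixingError_nonneg)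
    (fun z hz => by linarith [(abs_le.1 (h.abs_surv_sub_le hz s)).2]) x
  have h2 : Y.surv (basin Y Y' A α R f ∪ Aᶜ) R.toNNReal x < r := h.recurrence x
  linarith

theorem HpG.abs_survLaw_sub_le (h : HpG Y Y' A hA α R d f r) {μ : stdSimplex ℝ S}
    (hμ : Function.support μ.1 ⊆ basin Y Y' A α R f) (s : ℝ≥0) :
    |Y.survLaw Aᶜ μ s - Y.survLaw Aᶜ (M.piRestrict A hA) s| ≤ mixingError α d f := by
  have e : Y.survLaw Aᶜ μ s - Y.survLaw Aᶜ (M.piRestrict A hA) s =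
      ∑ x, μ.1 x * (Y.surv Aᶜ s x - Y.survLaw Aᶜ (M.piRestrict A hA) s) := by
    simp_rw [mul_sub]
    rw [Finset.sum_sub_distrib, ← Finset.sum_mul, μ.2.2, one_mul, ← survLaw_eq_sum]
  rw [e]
  refine (Finset.abs_sum_le_sum_abs _ _).trans ?_
  calc ∑ x, |μ.1 x * (Y.surv Aᶜ s x - Y.survLaw Aᶜ (M.piRestrict A hA) s)|
      ≤ ∑ x, μ.1 x * mixingError α d f := by
        refine Finset.sum_le_sum fun x _ => ?_
        rw [abs_mul, abs_of_nonneg (μ.2.1 x)]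
        by_cases hx : μ.1 x = 0
        · rw [hx, zero_mul, zero_mul]
        · exact mul_le_mul_of_nonneg_left (h.abs_surv_sub_le (hμ hx) s) (μ.2.1 x)
    _ = mixingError α d f := by rw [← Finset.sum_mul, μ.2.2, one_mul]

theorem HpG.one_sub_le_survLaw (h : HpG Y Y' A hA α R d f r) :
    1 - f ≤ Y.survLaw Aᶜ (M.piRestrict A hA) (2 * R.toNNReal) := by
  have h1 := h.slow_escape
  have e : (2 * R).toNNReal = 2 * R.toNNReal := by
    rw [Real.toNNReal_mul (by norm_num)]; simp
  have h2 : (Y.law (M.piRestrict A hA)).real {ω | Y.hit Aᶜ ω ≤ ENNReal.ofReal (2 * R)} =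
      1 - Y.survLaw Aᶜ (M.piRestrict A hA) (2 * R.toNNReal) := by
    rw [survLaw, ← probReal_compl_eq_one_sub (Y.measurableSet_lt_hit Aᶜ _), ENNReal.ofReal, e]
    congr 1
    ext ω
    simp
  linarith

end Estimates

/-! ### Irreducibility, geometric tails and finite means -/

section Matrix

attribute [local instance] Matrix.linftyOpNormedRing Matrix.linftyOpNormedAlgebra

theorem hasDerivAt_exp_smul_apply_zero {S : Type*} [Fintype S] [DecidableEq S]
    (Q : Matrix S S ℝ) (a b : S) :
    HasDerivAt (fun t : ℝ => NormedSpace.exp (t • Q) a b) (Q a b) 0 := by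
  have h := hasDerivAt_exp_smul_const (𝕂 := ℝ) Q (0 : ℝ)
  have h2 := ((Matrix.entryLinearMap ℝ ℝ a b).toContinuousLinearMap.hasFDerivAt
    (x := NormedSpace.exp ((0 : ℝ) • Q))).comp_hasDerivAt 0 h
  have e : (Matrix.entryLinearMap ℝ ℝ a b).toContinuousLinearMap
      (NormedSpace.exp ((0 : ℝ) • Q) * Q) = Q a b := by
    rw [zero_smul, NormedSpace.exp_zero, one_mul]
    rfl
  rw [← e]
  exact h2

end Matrix

section Irreducible

variable {S : Type*} [Fintype S] [DecidableEq S] {M : IrreducibleChain S}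

theorem IrreducibleChain.ne_of_rate_pos {S : Type*} [Fintype S] {M : IrreducibleChain S}
    {a b : S} (h : 0 < M.Q a b) : a ≠ b := by
  classical
  rintro rfl
  have h1 := M.row_sum a
  rw [← Finset.add_sum_erase _ _ (Finset.mem_univ a)] at h1
  have h2 : 0 ≤ ∑ y ∈ Finset.univ.erase a, M.Q a y :=
    Finset.sum_nonneg fun y hy => M.rate_nonneg a y (Finset.ne_of_mem_erase hy).symm
  linarith

/-- The entry vanishes at time 0, where its derivative is the positive rate. -/
theorem exists_exp_pos_of_rate_pos {a b : S} (h : 0 < M.Q a b) :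
    ∃ t : ℝ≥0, 0 < NormedSpace.exp ((t : ℝ) • M.Q) a b := by
  have hd := (hasDerivAt_iff_tendsto_slope.1 (hasDerivAt_exp_smul_apply_zero M.Q a b)).mono_left
    (nhdsWithin_mono (0 : ℝ) (fun x (hx : x ∈ Set.Ioi 0) => ne_of_gt hx))
  obtain ⟨t, ht, ht0⟩ := ((hd.eventually_const_lt h).and self_mem_nhdsWithin).exists
  have ht0' : 0 < t := ht0
  refine ⟨⟨t, ht0'.le⟩, ?_⟩
  rw [slope_def_field] at ht
  simp only [zero_smul, NormedSpace.exp_zero, Matrix.one_apply_ne (IrreducibleChain.ne_of_rate_pos h),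
    sub_zero] at ht
  exact (div_pos_iff_of_pos_right ht0').1 ht

theorem exists_exp_pos (Y : MarkovProcess M.Q) (x y : S) :
    ∃ t : ℝ≥0, 0 < NormedSpace.exp ((t : ℝ) • M.Q) x y := by
  have hxy := M.irreducible x y
  induction hxy with
  | refl => exact ⟨0, by simp⟩
  | @tail b c _ hbc ih =>
    obtain ⟨t, ht⟩ := ih
    obtain ⟨s, hs⟩ := exists_exp_pos_of_rate_pos hbc
    refine ⟨t + s, ?_⟩
    rw [NNReal.coe_add, add_smul, Matrix.exp_add_of_commute _ _
      (((Commute.refl M.Q).smul_left _).smul_right _), Matrix.mul_apply]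
    exact Finset.sum_pos' (fun z _ => mul_nonneg (Y.exp_nonneg _ _ _) (Y.exp_nonneg _ _ _))
      ⟨b, Finset.mem_univ b, mul_pos ht hs⟩

theorem exists_surv_le_lt_one (Y : MarkovProcess M.Q) {K : Set S} (hK : K.Nonempty) :
    ∃ T : ℝ≥0, 0 < T ∧ ∃ q < 1, ∀ x, Y.surv K T x ≤ q := by
  obtain ⟨g, hg⟩ := hK
  have h1 : ∀ x, ∃ t, Y.surv K t x < 1 := by
    intro x
    obtain ⟨t, ht⟩ := exists_exp_pos Y x g
    refine ⟨t, ?_⟩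
    rw [← Y.sum_exp t x, surv_eq_sum]
    refine Finset.sum_lt_sum (fun y _ => Y.killed_le_exp K t x y) ⟨g, Finset.mem_univ g, ?_⟩
    rwa [Y.killed_of_mem _ _ _ hg]
  choose t ht using h1
  have : Nonempty S := ⟨g⟩
  -- The sum dominates every `t x`, so one time serves all states; the `1` keeps it positive.
  obtain ⟨x₀, hx₀⟩ := Finite.exists_max fun x => Y.surv K (∑ z, t z + 1) x
  refine ⟨∑ z, t z + 1, by positivity, _, ?_, hx₀⟩
  refine (Y.surv_antitone K x₀ ?_).trans_lt (ht x₀)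
  exact (Finset.single_le_sum (fun z _ => zero_le) (Finset.mem_univ x₀)).trans (by simp)

end Irreducible

/-- Bound τ by `T` times the number of k with kT < τ, then sum the geometric series. -/
theorem lintegral_lt_top_of_geometric_tail {Ω : Type*} [MeasurableSpace Ω] {P : Measure Ω}
    [IsFiniteMeasure P] {τ : Ω → ℝ≥0∞} (hτ : Measurable τ) {T : ℝ≥0} (hT : 0 < T) {q : ℝ}
    (hq0 : 0 ≤ q) (hq : q < 1) (h : ∀ k : ℕ, P.real {ω | ((k * T : ℝ≥0) : ℝ≥0∞) < τ ω} ≤ q ^ k) :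
    ∫⁻ ω, τ ω ∂P < ∞ := by
  have hm : ∀ k : ℕ, MeasurableSet {ω | ((k * T : ℝ≥0) : ℝ≥0∞) < τ ω} := fun k =>
    measurableSet_lt measurable_const hτ
  have hle : ∀ ω, τ ω ≤ T * ∑' k : ℕ, {ω | ((k * T : ℝ≥0) : ℝ≥0∞) < τ ω}.indicator 1 ω := by
    intro ω
    by_cases hall : ∀ k : ℕ, ((k * T : ℝ≥0) : ℝ≥0∞) < τ ω
    · have : ∑' k : ℕ, {ω | ((k * T : ℝ≥0) : ℝ≥0∞) < τ ω}.indicator (1 : Ω → ℝ≥0∞) ω = ∞ := by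
        rw [← ENNReal.tsum_const_eq_top_of_ne_zero (α := ℕ) one_ne_zero]
        refine tsum_congr fun k => ?_
        rw [Set.indicator_of_mem (show ω ∈ {ω | _ < τ ω} from hall k)]
        rfl
      rw [this, ENNReal.mul_top (by exact_mod_cast hT.ne')]
      exact le_top
    · push Not at hall
      classical
      have h1 := Nat.find_spec hall
      set k := Nat.find hall with hk
      calc τ ω ≤ ((k * T : ℝ≥0) : ℝ≥0∞) := h1
        _ = T * ∑ j ∈ Finset.range k,
            {ω | ((j * T : ℝ≥0) : ℝ≥0∞) < τ ω}.indicator (1 : Ω → ℝ≥0∞) ω := by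
          rw [Finset.sum_congr rfl (g := fun _ => (1 : ℝ≥0∞))]
          · push_cast; simp [mul_comm]
          · intro j hj
            have := Nat.find_min hall (hk ▸ Finset.mem_range.1 hj)
            rw [Set.indicator_of_mem (show ω ∈ {ω | _ < τ ω} from not_le.1 this)]
            rfl
        _ ≤ _ := by gcongr; exact ENNReal.sum_le_tsum _
  calc ∫⁻ ω, τ ω ∂P
      ≤ ∫⁻ ω, T * ∑' k : ℕ, {ω | ((k * T : ℝ≥0) : ℝ≥0∞) < τ ω}.indicator 1 ω ∂P :=
        lintegral_mono hle
    _ = T * ∑' k : ℕ, P {ω | ((k * T : ℝ≥0) : ℝ≥0∞) < τ ω} := by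
        rw [lintegral_const_mul' _ _ ENNReal.coe_ne_top, lintegral_tsum fun k =>
          (measurable_one.indicator (hm k)).aemeasurable]
        simp_rw [lintegral_indicator_one (hm _)]
    _ ≤ T * ∑' k : ℕ, ENNReal.ofReal (q ^ k) := by
        gcongr with k
        rw [← ofReal_measureReal]
        exact ENNReal.ofReal_le_ofReal (h k)
    _ < ∞ := by
        rw [← ENNReal.ofReal_tsum_of_nonneg (fun k => pow_nonneg hq0 k)
          (summable_geometric_of_lt_one hq0 hq)]
        exact ENNReal.mul_lt_top ENNReal.coe_lt_top ENNReal.ofReal_lt_top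

section Mean

variable {S : Type*} [Fintype S] [DecidableEq S] {M : IrreducibleChain S}

theorem meanHit_lt_top (Y : MarkovProcess M.Q) {K : Set S} (hK : K.Nonempty)
    (ν : stdSimplex ℝ S) : Y.meanHit K ν < ∞ := by
  obtain ⟨T, hT, q, hq, h⟩ := exists_surv_le_lt_one Y hK
  obtain ⟨g, -⟩ := hK
  exact lintegral_lt_top_of_geometric_tail (Y.measurable_hit K) hT
    ((Y.surv_nonneg K T g).trans (h g)) hq
    fun k => Y.survLaw_le ν fun x => Y.surv_geometric h k x

theorem meanHit_pos {Q : Matrix S S ℝ} (Y : MarkovProcess Q) {K : Set S} {ν : stdSimplex ℝ S}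
    (h : Function.support ν.1 ⊆ Kᶜ) : 0 < Y.meanHit K ν := by
  refine pos_iff_ne_zero.2 fun h0 => ?_
  have h1 := (lintegral_eq_zero_iff (Y.measurable_hit K)).1 h0
  have h2 := Y.survLaw_zero h
  rw [survLaw, measureReal_def] at h2
  have h3 : Y.law ν {ω | ((0 : ℝ≥0) : ℝ≥0∞) < Y.hit K ω} = 0 := by
    refine measure_mono_null (fun ω hω => ?_) h1
    simpa [pos_iff_ne_zero] using hω
  rw [h3] at h2
  simp at h2

end Mean

/-- Squeezing by limits at nearby parameters `v`, using continuity of the exponential. At `u = 0`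
nothing lies below, and `g ≤ 1` supplies the upper bound. -/
theorem tendsto_exp_neg_of_sandwich {g : ℕ → ℝ} {u : ℝ≥0} (hg : ∀ n, g n ≤ 1)
    (hlow : ∀ c > u, ∃ v ∈ Set.Ioo u c, ∃ h : ℕ → ℝ,
      Tendsto h atTop (𝓝 (Real.exp (-v))) ∧ ∀ᶠ n in atTop, h n ≤ g n)
    (hup : ∀ c < u, ∃ v ∈ Set.Ioo c u, ∃ h : ℕ → ℝ,
      Tendsto h atTop (𝓝 (Real.exp (-v))) ∧ ∀ᶠ n in atTop, g n ≤ h n) :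
    Tendsto g atTop (𝓝 (Real.exp (-u))) := by
  have hc : Continuous fun v : ℝ≥0 => Real.exp (-v) := by fun_prop
  refine tendsto_order.2 ⟨fun a ha => ?_, fun a ha => ?_⟩
  · have h1 : ∀ᶠ v : ℝ≥0 in 𝓝[>] u, a < Real.exp (-v) :=
      (hc.tendsto u).mono_left nhdsWithin_le_nhds |>.eventually_const_lt ha
    obtain ⟨c, hc, hsub⟩ := (mem_nhdsGT_iff_exists_Ioo_subset' (show u < u + 1 by simp)).1 h1
    obtain ⟨v, hv, h, hh, hle⟩ := hlow c hc
    filter_upwards [hle, hh.eventually_const_lt (hsub hv)] with n h1 h2 using h2.trans_le h1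
  · rcases eq_zero_or_pos u with rfl | hu
    · simp only [NNReal.coe_zero, neg_zero, Real.exp_zero] at ha
      exact Eventually.of_forall fun n => (hg n).trans_lt ha
    · have h1 : ∀ᶠ v : ℝ≥0 in 𝓝[<] u, Real.exp (-v) < a :=
        (hc.tendsto u).mono_left nhdsWithin_le_nhds |>.eventually_lt_const ha
      obtain ⟨c, hc, hsub⟩ := (mem_nhdsLT_iff_exists_Ioo_subset' hu).1 h1
      obtain ⟨v, hv, h, hh, hle⟩ := hup c hc
      filter_upwards [hle, hh.eventually_lt_const (hsub hv)] with n h1 h2 using h1.trans_lt h2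

/-! ### Almost multiplicative survival functions -/

section AlmostMultiplicative

theorem abs_nat_mul_sub_pow_le {φ : ℝ≥0 → ℝ} {δ : ℝ} (h0 : φ 0 = 1) (hφ0 : ∀ t, 0 ≤ φ t)
    (hφ1 : ∀ t, φ t ≤ 1) (hφ : ∀ t s, |φ (t + s) - φ t * φ s| ≤ δ) (k : ℕ) (s : ℝ≥0) :
    |φ (k * s) - φ s ^ k| ≤ k * δ := by
  induction k with
  | zero => simp [h0]
  | succ k ih =>
    have h1 := hφ (k * s) s
    have e : ((k + 1 : ℕ) : ℝ≥0) * s = k * s + s := by push_cast; ring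
    rw [e, pow_succ]
    have h2 : |φ (k * s) * φ s - φ s ^ k * φ s| ≤ k * δ := by
      rw [← sub_mul, abs_mul, abs_of_nonneg (hφ0 s)]
      exact (mul_le_of_le_one_right (abs_nonneg _) (hφ1 s)).trans ih
    push_cast
    calc |φ (k * s + s) - φ s ^ k * φ s|
        ≤ |φ (k * s + s) - φ (k * s) * φ s| + |φ (k * s) * φ s - φ s ^ k * φ s| :=
          abs_sub_le _ _ _
      _ ≤ (k + 1) * δ := by linarith

/-- φ(T/q)^q is close to φ(T), so take q-th roots and then p-th powers; the errors are a fixed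
multiple of δ. -/
theorem tendsto_rational_exp_of_almost_mul {φ : ℕ → ℝ≥0 → ℝ} {δ : ℕ → ℝ} {T : ℕ → ℝ≥0}
    (h0 : ∀ n, φ n 0 = 1) (hφ0 : ∀ n t, 0 ≤ φ n t) (hφ1 : ∀ n t, φ n t ≤ 1)
    (hφ : ∀ n t s, |φ n (t + s) - φ n t * φ n s| ≤ δ n) (hδ : Tendsto δ atTop (𝓝 0))
    (hT : Tendsto (fun n => φ n (T n)) atTop (𝓝 (Real.exp (-1)))) (p : ℕ) {q : ℕ} (hq : q ≠ 0) :
    Tendsto (fun n => φ n ((p / q : ℝ≥0) * T n)) atTop (𝓝 (Real.exp (-(p / q : ℝ≥0)))) := by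
  have hlim : ∀ k : ℕ, ∀ s : ℕ → ℝ≥0,
      Tendsto (fun n => φ n (k * s n) - φ n (s n) ^ k) atTop (𝓝 0) := by
    intro k s
    refine squeeze_zero_norm (fun n => ?_) (by simpa using hδ.const_mul (k : ℝ))
    exact abs_nat_mul_sub_pow_le (h0 n) (hφ0 n) (hφ1 n) (hφ n) k (s n)
  have hq' : (q : ℝ≥0) ≠ 0 := by exact_mod_cast hq
  have h1 : Tendsto (fun n => φ n (T n / q) ^ q) atTop (𝓝 (Real.exp (-1))) := by
    have := hT.sub (hlim q fun n => T n / q)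
    simp only [mul_div_cancel₀ _ hq', sub_sub_cancel, sub_zero] at this
    exact this
  have h2 : Tendsto (fun n => φ n (T n / q)) atTop (𝓝 (Real.exp (-1) ^ ((q : ℝ)⁻¹))) := by
    refine (h1.rpow_const (p := (q : ℝ)⁻¹) (Or.inl (Real.exp_pos _).ne')).congr fun n => ?_
    exact Real.pow_rpow_inv_natCast (hφ0 n _) hq
  have h3 := (hlim p fun n => T n / q).add (h2.pow p)
  simp only [sub_add_cancel, zero_add] at h3
  have e : (Real.exp (-1) ^ ((q : ℝ)⁻¹)) ^ p = Real.exp (-(p / q : ℝ≥0)) := by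
    rw [← Real.exp_mul, ← Real.exp_nat_mul]
    congr 1
    push_cast
    ring
  rw [e] at h3
  refine h3.congr fun n => ?_
  congr 1
  ring

theorem exists_nat_div_mem_Ioo {a b : ℝ≥0} (h : a < b) :
    ∃ p q : ℕ, q ≠ 0 ∧ (p / q : ℝ≥0) ∈ Set.Ioo a b := by
  obtain ⟨r, h1, h2⟩ := exists_rat_btwn (show (a : ℝ) < b by exact_mod_cast h)
  have hr : 0 ≤ r := by
    have : (0 : ℝ) ≤ r := a.2.trans h1.le
    exact_mod_cast this
  lift r to ℚ≥0 using hr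
  refine ⟨r.num, r.den, r.den_ne_zero, ?_⟩
  have e : ((r : ℚ) : ℝ) = (r.num : ℝ) / r.den := by
    conv_lhs => rw [← NNRat.num_div_den r]
    push_cast
    rfl
  rw [e] at h1 h2
  exact ⟨by exact_mod_cast h1, by exact_mod_cast h2⟩

theorem tendsto_exp_of_almost_mul {φ : ℕ → ℝ≥0 → ℝ} {δ : ℕ → ℝ} {T : ℕ → ℝ≥0}
    (h0 : ∀ n, φ n 0 = 1) (hanti : ∀ n, Antitone (φ n)) (hφ0 : ∀ n t, 0 ≤ φ n t)
    (hφ : ∀ n t s, |φ n (t + s) - φ n t * φ n s| ≤ δ n) (hδ : Tendsto δ atTop (𝓝 0))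
    (hT : Tendsto (fun n => φ n (T n)) atTop (𝓝 (Real.exp (-1)))) (u : ℝ≥0) :
    Tendsto (fun n => φ n (u * T n)) atTop (𝓝 (Real.exp (-u))) := by
  have hφ1 : ∀ n t, φ n t ≤ 1 := fun n t => (hanti n zero_le).trans (h0 n).le
  refine tendsto_exp_neg_of_sandwich (fun n => hφ1 n _) (fun c hc => ?_) (fun c hc => ?_)
  · obtain ⟨p, q, hq, hv⟩ := exists_nat_div_mem_Ioo hc
    refine ⟨_, hv, _, tendsto_rational_exp_of_almost_mul h0 hφ0 hφ1 hφ hδ hT p hq,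
      Eventually.of_forall fun n => hanti n ?_⟩
    gcongr
    exact hv.1.le
  · obtain ⟨p, q, hq, hv⟩ := exists_nat_div_mem_Ioo hc
    refine ⟨_, hv, _, tendsto_rational_exp_of_almost_mul h0 hφ0 hφ1 hφ hδ hT p hq,
      Eventually.of_forall fun n => hanti n ?_⟩
    gcongr
    exact hv.2.le

/-- An almost multiplicative survival function that is close to one at time `2 * R` takes a value
close to `c` at some time after `2 * R`. -/
theorem exists_scale_of_almost_mul {φ : ℝ≥0 → ℝ} {δ f c : ℝ} {R : ℝ≥0} (hR : 0 < R)
    (hanti : Antitone φ) (hφ0 : ∀ t, 0 ≤ φ t) (hφ : ∀ t s, |φ (t + s) - φ t * φ s| ≤ δ)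
    (hc : 0 ≤ c) (h2R : 1 - f ≤ φ (2 * R)) (hcf : c < 1 - f) (hsmall : ∃ t, φ t ≤ c) :
    ∃ T, 2 * R ≤ T ∧ c * (1 - f) - δ ≤ φ T ∧ φ T ≤ (c + δ) / (1 - f) := by
  -- Take T to be the infimum of this set. Continuity of φ at T is not needed: φ exceeds `c` at T -
  -- R and is at most `c` at T + R, and near multiplicativity over this gap of length 2R, where
  -- φ(2R) is almost one, limits the drop.
  set s := {t | φ t ≤ c} with hs
  have hlb : ∀ t ∈ s, 2 * R ≤ t := by
    intro t ht
    by_contra hlt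
    have : φ (2 * R) ≤ φ t := hanti (not_le.1 hlt).le
    have : φ t ≤ c := ht
    linarith
  have hT : 2 * R ≤ sInf s := le_csInf hsmall hlb
  have hRT : R ≤ sInf s := le_trans (by rw [two_mul]; exact le_self_add) hT
  have hlow : c < φ (sInf s - R) := by
    by_contra hle
    have h1 : sInf s ≤ sInf s - R := csInf_le (OrderBot.bddBelow _) (not_lt.1 hle)
    have h2 : sInf s - R < sInf s := tsub_lt_self (hR.trans_le hRT) hR
    exact absurd h1 (not_le.2 h2)
  have hupp : φ (sInf s + R) ≤ c := by
    obtain ⟨t, ht, hlt⟩ := exists_lt_of_csInf_lt hsmall (show sInf s < sInf s + R by simpa using hR)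
    exact (hanti hlt.le).trans ht
  have e : sInf s - R + 2 * R = sInf s + R := by
    rw [two_mul, ← add_assoc, tsub_add_cancel_of_le hRT]
  have hm := abs_le.1 (hφ (sInf s - R) (2 * R))
  rw [e] at hm
  have h1 : φ (sInf s + R) ≤ φ (sInf s) := hanti le_self_add
  have h2 : φ (sInf s) ≤ φ (sInf s - R) := hanti tsub_le_self
  have hf : 0 < 1 - f := hc.trans_lt hcf
  have h3 : c * (1 - f) ≤ φ (sInf s - R) * φ (2 * R) :=
    mul_le_mul hlow.le h2R hf.le (hφ0 _)
  have h4 : φ (sInf s) * (1 - f) ≤ φ (sInf s - R) * φ (2 * R) :=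
    mul_le_mul h2 h2R hf.le (hφ0 _)
  refine ⟨sInf s, hT, by linarith [hm.1, hm.2], ?_⟩
  rw [le_div_iff₀ hf]
  linarith [hm.1, hm.2]

end AlmostMultiplicative

/-! ### From tails to means and convergence in law -/

section ConvergenceInLaw

theorem lintegral_exp_neg_Ioi_zero :
    ∫⁻ u in Set.Ioi (0 : ℝ), ENNReal.ofReal (Real.exp (-u)) = 1 := by
  rw [← ofReal_integral_eq_lintegral_ofReal]
  · rw [integral_exp_neg_Ioi_zero, ENNReal.ofReal_one]
  · have h := exp_neg_integrableOn_Ioi 0 one_pos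
    simp only [neg_mul, one_mul] at h
    exact h
  · exact Eventually.of_forall fun x => (Real.exp_pos _).le

/-- The layer-cake formula for τ/T, where τ is finite almost surely. -/
theorem lintegral_eq_mul_lintegral_tail {Ω : Type*} [MeasurableSpace Ω] {P : Measure Ω}
    {τ : Ω → ℝ≥0∞} (hτ : Measurable τ) (hfin : ∫⁻ ω, τ ω ∂P ≠ ∞) {T : ℝ≥0} (hT : 0 < T) :
    ∫⁻ ω, τ ω ∂P = T * ∫⁻ u in Set.Ioi (0 : ℝ),
      P {ω | ((u.toNNReal * T : ℝ≥0) : ℝ≥0∞) < τ ω} := by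
  have hae : ∀ᵐ ω ∂P, τ ω ≠ ∞ := (ae_lt_top hτ hfin).mono fun ω h => h.ne
  have hT0 : (T : ℝ≥0∞) ≠ 0 := by exact_mod_cast hT.ne'
  have h := lintegral_eq_lintegral_meas_lt P (f := fun ω => (τ ω / T).toReal)
    (Eventually.of_forall fun ω => ENNReal.toReal_nonneg)
    (hτ.div_const _).ennreal_toReal.aemeasurable
  have e1 : ∫⁻ ω, ENNReal.ofReal (τ ω / T).toReal ∂P = (∫⁻ ω, τ ω ∂P) / T := by
    rw [div_eq_mul_inv, ← lintegral_mul_const _ hτ]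
    refine lintegral_congr_ae (hae.mono fun ω h => ?_)
    simp only
    rw [ENNReal.ofReal_toReal (ENNReal.div_ne_top h hT0), div_eq_mul_inv]
  have e2 : ∫⁻ u in Set.Ioi (0 : ℝ), P {ω | u < (τ ω / T).toReal} =
      ∫⁻ u in Set.Ioi (0 : ℝ), P {ω | ((u.toNNReal * T : ℝ≥0) : ℝ≥0∞) < τ ω} := by
    refine setLIntegral_congr_fun measurableSet_Ioi fun u hu => measure_congr ?_
    refine hae.mono fun ω h => propext ?_
    change u < (τ ω / T).toReal ↔ ((u.toNNReal * T : ℝ≥0) : ℝ≥0∞) < τ ω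
    rw [← ENNReal.ofReal_lt_iff_lt_toReal (le_of_lt hu) (ENNReal.div_ne_top h hT0),
      ENNReal.lt_div_iff_mul_lt (Or.inl hT0) (Or.inl ENNReal.coe_ne_top), ENNReal.coe_mul]
    rfl
  rw [← e2, ← h, e1, ENNReal.mul_div_cancel hT0 ENNReal.coe_ne_top]

variable {Ω : ℕ → Type*} [∀ n, MeasurableSpace (Ω n)] {P : ∀ n, Measure (Ω n)}
  [∀ n, IsProbabilityMeasure (P n)]

theorem tendsto_lintegral_tail {τ : ∀ n, Ω n → ℝ≥0∞} {T : ℕ → ℝ≥0}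
    (hlim : ∀ u : ℝ≥0, Tendsto (fun n => (P n).real {ω | ((u * T n : ℝ≥0) : ℝ≥0∞) < τ n ω}) atTop
      (𝓝 (Real.exp (-u))))
    (htail : ∀ᶠ n in atTop, ∀ k : ℕ,
      (P n).real {ω | ((k * (2 * T n) : ℝ≥0) : ℝ≥0∞) < τ n ω} ≤ (1 / 2) ^ k) :
    Tendsto (fun n => ∫⁻ u in Set.Ioi (0 : ℝ),
      P n {ω | ((u.toNNReal * T n : ℝ≥0) : ℝ≥0∞) < τ n ω}) atTop (𝓝 1) := by
  rw [← lintegral_exp_neg_Ioi_zero]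
  have hlog : 0 < Real.log 2 / 2 := by have := Real.log_pos one_lt_two; positivity
  -- The tail at `u` is at most (1/2)^⌊u/2⌋, and ⌊u/2⌋ > u/2 - 1 makes this at most 2·2^(-u/2).
  refine tendsto_lintegral_filter_of_dominated_convergence
    (fun u => ENNReal.ofReal (2 * Real.exp (-(Real.log 2 / 2) * u))) ?_ ?_ ?_ ?_
  · refine Eventually.of_forall fun n => ?_
    refine Antitone.measurable fun u v huv => measure_mono fun ω h => ?_
    refine lt_of_le_of_lt ?_ (Set.mem_ofPred.1 h)
    gcongr
  · filter_upwards [htail] with n hn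
    refine (ae_restrict_mem measurableSet_Ioi).mono fun u hu => ?_
    have hu : (0 : ℝ) < u := hu
    rw [← ofReal_measureReal]
    refine ENNReal.ofReal_le_ofReal ?_
    refine le_trans (measureReal_mono (fun ω h => ?_)) ((hn ⌊u / 2⌋₊).trans ?_)
    · refine lt_of_le_of_lt ?_ (Set.mem_ofPred.1 h)
      have : (⌊u / 2⌋₊ : ℝ) ≤ u / 2 := Nat.floor_le (by positivity)
      have h3 : ((⌊u / 2⌋₊ : ℝ≥0)) * 2 ≤ u.toNNReal := by
        rw [← NNReal.coe_le_coe, Real.coe_toNNReal _ hu.le]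
        push_cast
        linarith
      rw [← mul_assoc]
      gcongr
    · have h1 : u / 2 < ⌊u / 2⌋₊ + 1 := Nat.lt_floor_add_one _
      have e : ((1 : ℝ) / 2) ^ ⌊u / 2⌋₊ = 2 * Real.exp (-(Real.log 2) * (⌊u / 2⌋₊ + 1)) := by
        rw [neg_mul, Real.exp_neg, Real.exp_mul, Real.exp_log two_pos]
        have : (2 : ℝ) ^ ((⌊u / 2⌋₊ : ℝ) + 1) = 2 ^ ⌊u / 2⌋₊ * 2 := by
          rw [Real.rpow_add_one two_ne_zero, Real.rpow_natCast]
        rw [this, div_pow, one_pow]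
        field_simp
      rw [e]
      gcongr 2 * Real.exp ?_
      nlinarith [Real.log_pos one_lt_two]
  · refine ne_of_lt (IntegrableOn.setLIntegral_lt_top ?_)
    exact (exp_neg_integrableOn_Ioi 0 hlog).const_mul 2
  · refine (ae_restrict_mem measurableSet_Ioi).mono fun u hu => ?_
    have h := (ENNReal.continuous_ofReal.tendsto _).comp (hlim u.toNNReal)
    rw [Real.coe_toNNReal _ (le_of_lt hu)] at h
    refine h.congr fun n => ?_
    exact ofReal_measureReal

theorem tendsto_tail_mul_mean {τ : ∀ n, Ω n → ℝ≥0∞} (hτ : ∀ n, Measurable (τ n))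
    (hfin : ∀ n, ∫⁻ ω, τ n ω ∂P n ≠ ∞) {T : ℕ → ℝ≥0} (hT : ∀ n, 0 < T n)
    (hlim : ∀ u : ℝ≥0, Tendsto (fun n => (P n).real {ω | ((u * T n : ℝ≥0) : ℝ≥0∞) < τ n ω}) atTop
      (𝓝 (Real.exp (-u))))
    (htail : ∀ᶠ n in atTop, ∀ k : ℕ,
      (P n).real {ω | ((k * (2 * T n) : ℝ≥0) : ℝ≥0∞) < τ n ω} ≤ (1 / 2) ^ k) (u : ℝ≥0) :
    Tendsto (fun n => (P n).real {ω | u * ∫⁻ ω, τ n ω ∂P n < τ n ω}) atTop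
      (𝓝 (Real.exp (-u))) := by
  have hI := tendsto_lintegral_tail hlim htail
  have hm := fun n => lintegral_eq_mul_lintegral_tail (hτ n) (hfin n) (hT n)
  set I := fun n => ∫⁻ u in Set.Ioi (0 : ℝ), P n {ω | ((u.toNNReal * T n : ℝ≥0) : ℝ≥0∞) < τ n ω}
  -- The mean is `T n * I n` with `I n → 1`, so a threshold of `u` means eventually lies between
  -- those at `v * T n` for `v` on either side of `u`.
  have huI : Tendsto (fun n => u * I n) atTop (𝓝 (u : ℝ≥0∞)) := by
    simpa using ENNReal.Tendsto.const_mul hI (Or.inr (ENNReal.coe_ne_top (r := u)))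
  refine tendsto_exp_neg_of_sandwich (fun n => measureReal_le_one) (fun c hc => ?_)
    (fun c hc => ?_)
  · obtain ⟨v, hv⟩ := exists_between hc
    refine ⟨v, hv, _, hlim v, ?_⟩
    filter_upwards [huI.eventually_lt_const (ENNReal.coe_lt_coe.2 hv.1)] with n hn
    refine measureReal_mono fun ω h => ?_
    refine lt_of_le_of_lt ?_ (Set.mem_ofPred.1 h)
    rw [hm, ENNReal.coe_mul, mul_left_comm, mul_comm (v : ℝ≥0∞)]
    gcongr
  · obtain ⟨v, hv⟩ := exists_between hc
    refine ⟨v, hv, _, hlim v, ?_⟩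
    filter_upwards [huI.eventually_const_lt (ENNReal.coe_lt_coe.2 hv.2)] with n hn
    refine measureReal_mono fun ω h => ?_
    refine lt_of_le_of_lt ?_ (Set.mem_ofPred.1 h)
    rw [hm, ENNReal.coe_mul, mul_left_comm, mul_comm (v : ℝ≥0∞)]
    gcongr

/-- Half-open intervals form a π-system containing arbitrarily small neighbourhoods of each point,
and their masses are differences of distribution functions. -/
theorem tendsto_probabilityMeasure_of_tendsto_Iic {μ : ℕ → ProbabilityMeasure ℝ}
    {ν : ProbabilityMeasure ℝ}
    (h : ∀ x, Tendsto (fun n => (μ n : Measure ℝ).real (Set.Iic x)) atTop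
      (𝓝 ((ν : Measure ℝ).real (Set.Iic x)))) :
    Tendsto μ atTop (𝓝 ν) := by
  refine (isPiSystem_Ioc (id : ℝ → ℝ) id).tendsto_probabilityMeasure_of_tendsto_of_mem ?_ ?_ ?_
  · rintro s ⟨a, b, -, rfl⟩
    exact measurableSet_Ioc
  · intro u hu x hx
    obtain ⟨ε, hε, hsub⟩ := Metric.isOpen_iff.1 hu x hx
    refine ⟨Set.Ioc (x - ε / 2) (x + ε / 2), ⟨x - ε / 2, x + ε / 2, by simp; linarith, rfl⟩,
      Ioc_mem_nhds (by linarith) (by linarith), fun y hy => hsub ?_⟩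
    rw [Metric.mem_ball, Real.dist_eq, abs_lt]
    exact ⟨by linarith [hy.1], by linarith [hy.2]⟩
  · rintro s ⟨a, b, hab, rfl⟩
    have e : ∀ m : Measure ℝ, [IsProbabilityMeasure m] →
        m.real (Set.Iic b) - m.real (Set.Iic a) = m.real (Set.Ioc a b) := by
      intro m _
      rw [show Set.Ioc a b = Set.Iic b \ Set.Iic a by ext; simp [and_comm],
        measureReal_sdiff (Set.Iic_subset_Iic.2 (show a ≤ b from le_of_lt hab))
        measurableSet_Iic]
    have h2 := (h b).sub (h a)
    simp_rw [e] at h2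
    rw [← NNReal.tendsto_coe]
    exact h2

theorem tendstoInDistribution_exp {τ : ∀ n, Ω n → ℝ≥0∞} (hτ : ∀ n, Measurable (τ n))
    (hpos : ∀ n, 0 < ∫⁻ ω, τ n ω ∂P n) (hfin : ∀ n, ∫⁻ ω, τ n ω ∂P n < ∞)
    (hlim : ∀ u : ℝ≥0, Tendsto (fun n => (P n).real {ω | u * ∫⁻ ω, τ n ω ∂P n < τ n ω}) atTop
      (𝓝 (Real.exp (-u)))) :
    TendstoInDistribution (fun n ω => (τ n ω / ∫⁻ ω, τ n ω ∂P n).toReal) atTop (id : ℝ → ℝ) P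
      (expMeasure 1) := by
  have hmeas : ∀ n, Measurable fun ω => (τ n ω / ∫⁻ ω, τ n ω ∂P n).toReal := fun n =>
    ((hτ n).div_const _).ennreal_toReal
  refine ⟨fun n => (hmeas n).aemeasurable, aemeasurable_id, ?_⟩
  refine tendsto_probabilityMeasure_of_tendsto_Iic fun x => ?_
  simp only [ProbabilityMeasure.coe_mk, Measure.map_id]
  rw [← cdf_eq_real, cdf_expMeasure_eq one_pos]
  have hmap : ∀ n, ((P n).map fun ω => (τ n ω / ∫⁻ ω, τ n ω ∂P n).toReal).real (Set.Iic x) =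
      (P n).real {ω | (τ n ω / ∫⁻ ω, τ n ω ∂P n).toReal ≤ x} := fun n =>
    map_measureReal_apply (hmeas n) measurableSet_Iic
  simp_rw [hmap]
  split_ifs with hx
  · have h := (hlim x.toNNReal).const_sub 1
    rw [Real.coe_toNNReal _ hx] at h
    rw [one_mul]
    refine h.congr fun n => ?_
    rw [← probReal_compl_eq_one_sub (measurableSet_lt measurable_const (hτ n))]
    refine measureReal_congr ?_
    -- `toReal` sends `∞` to 0, so finiteness almost surely is needed to identify the events.
    filter_upwards [ae_lt_top (hτ n) (hfin n).ne] with ω hω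
    refine propext ?_
    change ¬ (_ < τ n ω) ↔ (τ n ω / ∫⁻ ω, τ n ω ∂P n).toReal ≤ x
    rw [not_lt, ← ENNReal.le_ofReal_iff_toReal_le (ENNReal.div_ne_top hω.ne (hpos n).ne') hx,
      ENNReal.div_le_iff (hpos n).ne' (hfin n).ne]
    rfl
  · refine tendsto_const_nhds.congr fun n => ?_
    rw [show {ω | (τ n ω / ∫⁻ ω, τ n ω ∂P n).toReal ≤ x} = ∅ from
      Set.eq_empty_of_forall_notMem fun ω h => hx (ENNReal.toReal_nonneg.trans h)]
    simp

end ConvergenceInLaw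

/-! ### The exit scale and the conclusion -/

theorem exists_survLaw_le {S : Type*} [Fintype S] [DecidableEq S] {M : IrreducibleChain S}
    (Y : MarkovProcess M.Q) {K : Set S} (hK : K.Nonempty) (ν : stdSimplex ℝ S) {c : ℝ}
    (hc : 0 < c) : ∃ t, Y.survLaw K ν t ≤ c := by
  obtain ⟨T, -, q, hq, h⟩ := exists_surv_le_lt_one Y hK
  obtain ⟨k, hk⟩ := exists_pow_lt_of_lt_one hc hq
  exact ⟨k * T, Y.survLaw_le ν fun x => (Y.surv_geometric h k x).trans hk.le⟩

theorem exp_neg_one_lt_half : Real.exp (-1) < 1 / 2 := by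
  rw [Real.exp_neg, inv_eq_one_div]
  exact one_div_lt_one_div_of_lt two_pos (by linarith [Real.exp_one_gt_d9])

variable {S : ℕ → Type*} [∀ n, Fintype (S n)] [∀ n, DecidableEq (S n)]
  {M : ∀ n, IrreducibleChain (S n)} {X : ∀ n, MarkovProcess (M n).Q}
  {X' : ∀ n, MarkovProcess (M n).reversedQ} {A : ∀ n, Set (S n)} {hA : ∀ n, (A n).Nonempty}
  {α : ℝ} {R d f r : ℕ → ℝ}

theorem tendsto_mixingError (hα : α ∈ Set.Ioo (0 : ℝ) 1) (hd : Tendsto d atTop (𝓝 0))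
    (hf : Tendsto f atTop (𝓝 0)) :
    Tendsto (fun n => mixingError α (d n) (f n)) atTop (𝓝 0) := by
  have h1 : ∀ β : ℝ, 0 < β → Tendsto (fun n => f n ^ β) atTop (𝓝 0) := fun β hβ => by
    simpa [Real.zero_rpow hβ.ne'] using hf.rpow_const (p := β) (Or.inr hβ.le)
  have := (((h1 α hα.1).const_mul 2).add (hd.const_mul 2)).add (h1 (1 - α) (sub_pos.2 hα.2))
  simpa [mixingError] using this

/-- The time scale of the exit from the trap. -/
theorem exists_exit_scale
    (hyp : ∀ n, HpG (X n) (X' n) (A n) (hA n) α (R n) (d n) (f n) (r n))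
    (hG : ∀ n, (A n)ᶜ.Nonempty) (hα : α ∈ Set.Ioo (0 : ℝ) 1)
    (hd : Tendsto d atTop (𝓝 0)) (hf : Tendsto f atTop (𝓝 0)) :
    ∃ T : ℕ → ℝ≥0, (∀ n, 2 * (R n).toNNReal ≤ T n) ∧
      Tendsto (fun n => (X n).survLaw (A n)ᶜ ((M n).piRestrict (A n) (hA n)) (T n)) atTop
        (𝓝 (Real.exp (-1))) := by
  have hη := tendsto_mixingError hα hd hf
  have hT : ∀ n, ∃ T, 2 * (R n).toNNReal ≤ T ∧ (Real.exp (-1) < 1 - f n →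
      Real.exp (-1) * (1 - f n) - 2 * mixingError α (d n) (f n) ≤
        (X n).survLaw (A n)ᶜ ((M n).piRestrict (A n) (hA n)) T ∧
      (X n).survLaw (A n)ᶜ ((M n).piRestrict (A n) (hA n)) T ≤
        (Real.exp (-1) + 2 * mixingError α (d n) (f n)) / (1 - f n)) := by
    intro n
    by_cases hn : Real.exp (-1) < 1 - f n
    · obtain ⟨T, h1, h2⟩ := exists_scale_of_almost_mul
        (Real.toNNReal_pos.2 (zero_lt_one.trans (hyp n).R_gt))
        ((X n).survLaw_antitone _ _) ((X n).survLaw_nonneg _ _)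
        (hyp n).abs_survLaw_add_sub_mul_le (Real.exp_pos _).le (hyp n).one_sub_le_survLaw hn
        (exists_survLaw_le (X n) (hG n) _ (Real.exp_pos _))
      exact ⟨T, h1, fun _ => h2⟩
    -- Only finitely many `n` fall here, as `f n → 0`; any time from 2R on will do.
    · exact ⟨_, le_rfl, fun h => absurd h hn⟩
  choose T hRT hT using hT
  refine ⟨T, hRT, ?_⟩
  have h1f : Tendsto (fun n => 1 - f n) atTop (𝓝 1) := by simpa using hf.const_sub 1
  have hsmall : ∀ᶠ n in atTop, Real.exp (-1) < 1 - f n :=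
    h1f.eventually_const_lt (by linarith [exp_neg_one_lt_half])
  refine tendsto_of_tendsto_of_tendsto_of_le_of_le' ?_ ?_ (hsmall.mono fun n hn => (hT n hn).1)
    (hsmall.mono fun n hn => (hT n hn).2)
  · simpa using (h1f.const_mul (Real.exp (-1))).sub (hη.const_mul 2)
  · have h := ((hη.const_mul 2).const_add (Real.exp (-1))).div h1f one_ne_zero
    simp only [mul_zero, add_zero, div_one] at h
    exact h

/-- The rescaled exit time is asymptotically exponential for any sequence of initial laws that
is carried by the traps and has almost the same survival probabilities as the restricted
invariant measure. -/
theorem rescaledHitTendstoExp_of_abs_survLaw_sub_le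
    (hyp : ∀ n, HpG (X n) (X' n) (A n) (hA n) α (R n) (d n) (f n) (r n))
    (hG : ∀ n, (A n)ᶜ.Nonempty) (hα : α ∈ Set.Ioo (0 : ℝ) 1)
    (hd : Tendsto d atTop (𝓝 0)) (hf : Tendsto f atTop (𝓝 0)) (hr : Tendsto r atTop (𝓝 0))
    (ν : ∀ n, stdSimplex ℝ (S n)) (hν : ∀ n, Function.support (ν n).1 ⊆ A n)
    (hclose : ∀ n s, |(X n).survLaw (A n)ᶜ (ν n) s -
      (X n).survLaw (A n)ᶜ ((M n).piRestrict (A n) (hA n)) s| ≤ mixingError α (d n) (f n)) :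
    RescaledHitTendstoExp X (fun n => (A n)ᶜ) ν := by
  have hη := tendsto_mixingError hα hd hf
  obtain ⟨T, hRT, hT⟩ := exists_exit_scale hyp hG hα hd hf
  have hR : ∀ n, 0 < (R n).toNNReal := fun n =>
    Real.toNNReal_pos.2 (zero_lt_one.trans (hyp n).R_gt)
  have hTpos : ∀ n, 0 < T n := fun n => (mul_pos two_pos (hR n)).trans_le (hRT n)
  have hlimπ := tendsto_exp_of_almost_mul
    (fun n => (X n).survLaw_zero ((support_piRestrict_subset (M := M n) (A n) (hA n)).trans_eq
      (compl_compl _).symm))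
    (fun n => (X n).survLaw_antitone _ _) (fun n => (X n).survLaw_nonneg _ _)
    (fun n => (hyp n).abs_survLaw_add_sub_mul_le) (by simpa using hη.const_mul 2) hT
  have hlim : ∀ u : ℝ≥0, Tendsto (fun n => (X n).survLaw (A n)ᶜ (ν n) (u * T n)) atTop
      (𝓝 (Real.exp (-u))) := by
    intro u
    have h0 : Tendsto (fun n => (X n).survLaw (A n)ᶜ (ν n) (u * T n) -
        (X n).survLaw (A n)ᶜ ((M n).piRestrict (A n) (hA n)) (u * T n)) atTop (𝓝 0) :=
      squeeze_zero_norm (fun n => hclose n _) hη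
    simpa using h0.add (hlimπ u)
  have htail : ∀ᶠ n in atTop, ∀ k : ℕ,
      (X n).survLaw (A n)ᶜ (ν n) (k * (2 * T n)) ≤ (1 / 2) ^ k := by
    -- This is the recurrence bound for survival up to T + R from any state. Its limit 1/e is below
    -- 1/2, and R ≤ T turns T + R into 2T.
    have h1 : Tendsto (fun n => r n +
        (X n).survLaw (A n)ᶜ ((M n).piRestrict (A n) (hA n)) (T n) +
        mixingError α (d n) (f n)) atTop (𝓝 (Real.exp (-1))) := by
      simpa using (hr.add hT).add hη
    filter_upwards [h1.eventually_lt_const exp_neg_one_lt_half] with n hn k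
    refine (X n).survLaw_le (ν n) fun x => (X n).surv_geometric (fun x => ?_) k x
    refine ((X n).surv_antitone (A n)ᶜ x ?_).trans (((hyp n).surv_add_le (T n) x).trans hn.le)
    rw [two_mul]
    gcongr
    exact (le_mul_of_one_le_left zero_le one_le_two).trans (hRT n)
  have hpos : ∀ n, 0 < (X n).meanHit (A n)ᶜ (ν n) := fun n =>
    meanHit_pos (X n) ((hν n).trans_eq (compl_compl _).symm)
  have hfin : ∀ n, (X n).meanHit (A n)ᶜ (ν n) < ∞ := fun n => meanHit_lt_top (X n) (hG n) (ν n)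
  have hmeas : ∀ n, Measurable ((X n).hit (A n)ᶜ) := fun n => (X n).measurable_hit _
  exact ⟨fun n => ⟨hpos n, hfin n⟩, tendstoInDistribution_exp hmeas hpos hfin
    (tendsto_tail_mul_mean hmeas (fun n => (hfin n).ne) hTpos hlim htail)⟩

end Metastability

theorem corollary3p10 {S : ℕ → Type*} [∀ n, Fintype (S n)] [∀ n, DecidableEq (S n)]
    (M : ∀ n, Metastability.IrreducibleChain (S n))
    (X : ∀ n, Metastability.MarkovProcess (M n).Q)
    (X' : ∀ n, Metastability.MarkovProcess (M n).reversedQ)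
    (A : ∀ n, Set (S n)) (hA : ∀ n, (A n).Nonempty) (hG : ∀ n, (A n)ᶜ.Nonempty)
    (α : ℝ) (hα : α ∈ Set.Ioo (0 : ℝ) 1) (R d f r : ℕ → ℝ)
    (hyp : ∀ n, Metastability.HpG (X n) (X' n) (A n) (hA n) α (R n) (d n) (f n) (r n))
    (hd : Tendsto d atTop (𝓝 0)) (hf : Tendsto f atTop (𝓝 0)) (hr : Tendsto r atTop (𝓝 0)) :
    Metastability.RescaledHitTendstoExp X (fun n => (A n)ᶜ)
        (fun n => (M n).piRestrict (A n) (hA n)) ∧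
      ∀ μ : ∀ n, stdSimplex ℝ (S n),
        (∀ n, Function.support (μ n).1 ⊆
          Metastability.basin (X n) (X' n) (A n) α (R n) (f n)) →
        Metastability.RescaledHitTendstoExp X (fun n => (A n)ᶜ) μ := by
  refine ⟨?_, fun μ hμ => ?_⟩
  · refine Metastability.rescaledHitTendstoExp_of_abs_survLaw_sub_le hyp hG hα hd hf hr _
      (fun n => Metastability.support_piRestrict_subset (A n) (hA n)) fun n s => ?_
    rw [sub_self, abs_zero]
    exact (hyp n).mixingError_nonneg
  · exact Metastability.rescaledHitTendstoExp_of_abs_survLaw_sub_le hyp hG hα hd hf hr μ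
      (fun n => (hμ n).trans fun x hx => hx.1) fun n s => (hyp n).abs_survLaw_sub_le (hμ n) s
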